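/- All graphs are finite and simple. For graphs $T,G$, the prodsimplicial complex $\mathrm{Hom}(T,G)\subseteq\prod_{x\in V(T)}\Delta^{V(G)}$ consists of the cells $\prod_{x}\sigma_x$ with $\emptyset\neq\sigma_x\subseteq V(G)$ such that, whenever $x,y$ are adjacent in $T$, every vertex of $\sigma_x$ is adjacent in $G$ to every vertex of $\sigma_y$. The bound given by the homology test for $G$ with test graph $T$ is the largest value of $d+1+\chi(T)$ over the integers $d\ge -1$ such that $\widetilde H_i(\mathrm{Hom}(T,G);\mathbb Z_2)=0$ for all $i\le d$ (where $\widetilde H_{-1}=0$ means that the complex is nonempty); if there is no such $d$, the test gives only the trivial bound $0$. **Proposition.** Let $G_1$ and $G_2$ be connected graphs with $\chi(G_1)\ge\chi(G_2)\ge 3$ and $G_2$ triangle-free. Let $t\ge 1$ and let $G$ be obtained from the disjoint union of $G_1$ and $G_2$ by identifying distinct vertices $v_1,\dots,v_t$ of $G_1$ with distinct vertices $w_1,\dots,w_t$ of $G_2$, $v_i$ with $w_i$. Assume that any path in $G$ connecting $v_i$ and $v_j$ with $i\ne j$ has at least $3$ edges. Then: 1. $\mathrm{Hom}(K_3,G)=\mathrm{Hom}(K_3,G_1)$,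 that is, the inclusion $V(G_1)\subseteq V(G)$ identifies the cells of the two complexes; hence the homology test with test graph $K_3$ gives the same bound for $G$ as for $G_1$. 2. $\mathrm{Hom}(K_2,G_1)$ and $\mathrm{Hom}(K_2,G_2)$ are nonempty, and $\mathrm{Hom}(K_2,G)$ is homotopy equivalent to the wedge of $\mathrm{Hom}(K_2,G_1)$, $\mathrm{Hom}(K_2,G_2)$ and $2t-1$ copies of the circle $S^1$, for any choice of base points. 3. The homology test for $G$ with test graph $K_2$ gives the bound $3$. -/

import Mathlib

open CategoryTheory CategoryTheory.Limits AlgebraicTopology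
open scoped ContinuousMap

namespace HomTest

/-! ### Hom complexes -/

/-- The cells of the prodsimplicial complex `Hom(T, G)`: a cell is a product of nonempty simplices
`σ x ⊆ V`, one for each vertex `x` of `T`, such that `(σ x, σ y)` is a complete bipartite subgraph
of `G` whenever `x` and `y` are adjacent in `T`. -/
def homCells {W V : Type*} (T : SimpleGraph W) (G : SimpleGraph V) : Set (W → Set V) :=
  {σ | (∀ x, (σ x).Nonempty) ∧ ∀ x y, T.Adj x y → ∀ a ∈ σ x, ∀ b ∈ σ y, G.Adj a b}

/-- The closed cell `∏ x, Δ^(σ x)` inside `∏ x, Δ^V`. -/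
def closedCell {W V : Type*} [Fintype V] (σ : W → Set V) : Set (W → V → ℝ) :=
  {p | ∀ x, p x ∈ stdSimplex ℝ V ∧ ∀ a, a ∉ σ x → p x a = 0}

/-- The complex `Hom(T, G)` as a subspace of `∏ x, Δ^V`: the union of its closed cells. -/
def homComplex {W V : Type*} [Fintype V] (T : SimpleGraph W) (G : SimpleGraph V) :
    Set (W → V → ℝ) :=
  ⋃ σ ∈ homCells T G, closedCell σ

/-! ### Reduced homology with coefficients in `ℤ/2` and the homology test -/

/-- Singular homology with coefficients in `ℤ/2`. -/
noncomputable def H2 (n : ℕ) : TopCat.{0} ⥤ ModuleCat.{0} (ZMod 2) :=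
  (singularHomologyFunctor (ModuleCat.{0} (ZMod 2)) n).obj (ModuleCat.of (ZMod 2) (ZMod 2))

/-- The map from a space to the one-point space. -/
def toPoint (X : TopCat.{0}) : X ⟶ TopCat.of PUnit.{1} :=
  TopCat.ofHom ⟨fun _ => PUnit.unit, continuous_const⟩

/-- Reduced homology with coefficients in `ℤ/2`, in every integer degree. In degree `n ≥ 0` it is
the kernel of `H_n(X) → H_n(pt)`, in degree `-1` it is the cokernel of `H_0(X) → H_0(pt)` (so it is
nonzero exactly for the empty space), and it vanishes in degrees below `-1`. -/
noncomputable def reducedH2 (X : TopCat.{0}) : ℤ → ModuleCat.{0} (ZMod 2)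
  | .ofNat n => kernel ((H2 n).map (toPoint X))
  | .negSucc 0 => cokernel ((H2 0).map (toPoint X))
  | .negSucc (_ + 1) => ModuleCat.of (ZMod 2) PUnit

/-- The bound on the chromatic number of `G` given by the homology test with test graph `T`: the
largest value of `d + 1 + χ(T)` over the integers `d ≥ -1` such that the reduced homology groups
of `Hom(T, G)` with coefficients in `ℤ/2` vanish in all degrees `i ≤ d`. Here `k = d + 1`. It is
the trivial bound `0` if no such `d` exists, that is, if `Hom(T, G)` is empty. -/
noncomputable def homologyTestBound {W V : Type} [Fintype V]
    (T : SimpleGraph W) (G : SimpleGraph V) : ℕ∞ :=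
  ⨆ (k : ℕ) (_ : ∀ i : ℤ, i < k → IsZero (reducedH2 (TopCat.of (homComplex T G)) i)),
    ((k : ℕ∞) + T.chromaticNumber)

/-! ### Gluing two graphs along vertices -/

/-- The identifications `v i ∼ w i`. -/
inductive GlueRel {V₁ V₂ : Type*} {t : ℕ} (v : Fin t ↪ V₁) (w : Fin t ↪ V₂) :
    V₁ ⊕ V₂ → V₁ ⊕ V₂ → Prop
  | glue (i : Fin t) : GlueRel v w (Sum.inl (v i)) (Sum.inr (w i))

/-- The vertex set obtained from the disjoint union of `V₁` and `V₂` by identifying `v i` with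
`w i` for all `i`. -/
def GlueVertex {V₁ V₂ : Type*} {t : ℕ} (v : Fin t ↪ V₁) (w : Fin t ↪ V₂) : Type _ :=
  Quot (GlueRel v w)

/-- The canonical map from `V₁` to the glued vertex set. -/
def glueInl {V₁ V₂ : Type*} {t : ℕ} (v : Fin t ↪ V₁) (w : Fin t ↪ V₂) (a : V₁) :
    GlueVertex v w :=
  Quot.mk _ (Sum.inl a)

/-- The canonical map from `V₂` to the glued vertex set. -/
def glueInr {V₁ V₂ : Type*} {t : ℕ} (v : Fin t ↪ V₁) (w : Fin t ↪ V₂) (b : V₂) :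
    GlueVertex v w :=
  Quot.mk _ (Sum.inr b)

noncomputable instance {V₁ V₂ : Type*} [Finite V₁] [Finite V₂] {t : ℕ}
    (v : Fin t ↪ V₁) (w : Fin t ↪ V₂) : Fintype (GlueVertex v w) :=
  haveI : Finite (GlueVertex v w) := inferInstanceAs (Finite (Quot (GlueRel v w)))
  Fintype.ofFinite _

theorem glueInl_injective {V₁ V₂ : Type*} {t : ℕ} (v : Fin t ↪ V₁) (w : Fin t ↪ V₂) :
    Function.Injective (glueInl v w) := by
  classical
  let f : V₁ ⊕ V₂ → V₁ ⊕ V₂ := Sum.elim Sum.inl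
    (fun b => if h : ∃ i, w i = b then Sum.inl (v h.choose) else Sum.inr b)
  have hf : ∀ a b, GlueRel v w a b → f a = f b := by
    rintro _ _ ⟨i⟩
    have h : ∃ j, w j = w i := ⟨i, rfl⟩
    have hc : h.choose = i := w.injective h.choose_spec
    simp only [f, Sum.elim_inl, Sum.elim_inr, dif_pos h, hc]
  intro a b hab
  have := congrArg (Quot.lift f hf) hab
  exact Sum.inl_injective this

theorem glueInr_injective {V₁ V₂ : Type*} {t : ℕ} (v : Fin t ↪ V₁) (w : Fin t ↪ V₂) :
    Function.Injective (glueInr v w) := by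
  classical
  let f : V₁ ⊕ V₂ → V₁ ⊕ V₂ := Sum.elim
    (fun a => if h : ∃ i, v i = a then Sum.inr (w h.choose) else Sum.inl a) Sum.inr
  have hf : ∀ a b, GlueRel v w a b → f a = f b := by
    rintro _ _ ⟨i⟩
    have h : ∃ j, v j = v i := ⟨i, rfl⟩
    have hc : h.choose = i := v.injective h.choose_spec
    simp only [f, Sum.elim_inl, Sum.elim_inr, dif_pos h, hc]
  intro a b hab
  have := congrArg (Quot.lift f hf) hab
  exact Sum.inr_injective this

/-- The graph obtained from `G₁` and `G₂` by identifying the vertices `v i` of `G₁` with the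
vertices `w i` of `G₂`: its edges are the images of the edges of `G₁` and of `G₂`. -/
def glueGraph {V₁ V₂ : Type*} {t : ℕ} (G₁ : SimpleGraph V₁) (G₂ : SimpleGraph V₂)
    (v : Fin t ↪ V₁) (w : Fin t ↪ V₂) : SimpleGraph (GlueVertex v w) :=
  G₁.map (glueInl v w) ⊔ G₂.map (glueInr v w)

/-! ### Wedges -/

/-- The base points in the disjoint union of `X`, `Y` and `n` circles. -/
inductive IsBasePoint {X Y : Type*} (x : X) (y : Y) (n : ℕ) : X ⊕ Y ⊕ (Fin n × Circle) → Prop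
  | fst : IsBasePoint x y n (Sum.inl x)
  | snd : IsBasePoint x y n (Sum.inr (Sum.inl y))
  | circle (j : Fin n) : IsBasePoint x y n (Sum.inr (Sum.inr (j, 1)))

/-- The wedge of the pointed spaces `(X, x)`, `(Y, y)` and `n` copies of the circle: the disjoint
union with all base points identified, with the quotient topology. -/
def WedgeCircles {X Y : Type*} (x : X) (y : Y) (n : ℕ) : Type _ :=
  Quot fun a b : X ⊕ Y ⊕ (Fin n × Circle) => IsBasePoint x y n a ∧ IsBasePoint x y n b

instance {X Y : Type*} [TopologicalSpace X] [TopologicalSpace Y] (x : X) (y : Y) (n : ℕ) :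
    TopologicalSpace (WedgeCircles x y n) :=
  inferInstanceAs (TopologicalSpace (Quot fun a b : X ⊕ Y ⊕ (Fin n × Circle) =>
    IsBasePoint x y n a ∧ IsBasePoint x y n b))

/-- The complete graph `K_n`. -/
abbrev K (n : ℕ) : SimpleGraph (Fin n) := ⊤

end HomTest

open HomTest

set_option linter.unusedSectionVars false

namespace HomTest

open scoped unitInterval

/-! ### Attaching arcs to a space -/

/-! Part 1 is local. An edge of the gluing comes from `G₁` or from `G₂`, so a triangle with a vertex
outside `V₁` would lie entirely in `G₂`. Since every vertex of `K₃` lies in a triangle, all cells of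
`Hom(K₃, G)` live over `V₁`.

For part 2, the cells of `Hom(K₂, G)` are ordered complete bipartite subgraphs. The distance
hypothesis says that glued vertices are pairwise nonadjacent and that distinct ones have no common
neighbour. Hence such a subgraph lies in `G₁`, in `G₂`, or is a star centred at a glued vertex
(`IsGluing.exists_of_mem`). The subcomplexes of `G₁` and `G₂` are disjoint. The stars at a fixed
glued vertex, with the centre in a fixed coordinate, form a simplex: the join of a face in one
subcomplex with a face in the other. These `2t` bridges are pairwise disjoint and convex, and
collapsing each to an arc is a homotopy equivalence (`BridgeData.homotopyEquivArcs`).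

A connected graph that is not 2-colorable has path-connected `Hom(K₂, -)`, so all arcs may be slid
until they run from `x` to `y`. Contracting one arc leaves the wedge with `2t - 1` circles
(`nonempty_arcAttach_homotopyEquiv_wedgeCircles`). This uses homotopy extension at `y`, available
because points of a Hom complex have star-shaped neighbourhoods.

For part 3, `G` is itself connected and not 2-colorable, so reduced homology vanishes up to degree
0. The wedge retracts onto a circle, whose first homology is detected by a winding cocycle. The
largest `d` is therefore 0, and the bound is `0 + 1 + 2`. -/

/-- The endpoints of the `k`-th arc are identified with `a k` and `b k`. -/
inductive ArcRel {A ι : Type*} (a b : ι → A) : A ⊕ ι × I → A ⊕ ι × I → Prop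
  | source (k : ι) : ArcRel a b (Sum.inr (k, 0)) (Sum.inl (a k))
  | target (k : ι) : ArcRel a b (Sum.inr (k, 1)) (Sum.inl (b k))

/-- The space obtained from `A` by attaching arcs from `a k` to `b k`. -/
def ArcAttach {A ι : Type*} (a b : ι → A) : Type _ := Quot (ArcRel a b)

theorem homotopic_of_trans_homotopic {Z : Type*} [TopologicalSpace Z] {x₀ x₁ y₀ y₁ : Z}
    {l : Path x₀ y₀} {r : Path x₁ y₁} {p : Path x₀ x₁} {q : Path y₀ y₁}
    (h : (l.trans q).Homotopic (p.trans r)) : ((l.symm.trans p).trans r).Homotopic q := by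
  rw [← Path.Homotopic.Quotient.eq] at h ⊢
  simp only [Path.Homotopic.Quotient.mk_trans, Path.Homotopic.Quotient.mk_symm] at h ⊢
  rw [Path.Homotopic.Quotient.trans_assoc, ← h, ← Path.Homotopic.Quotient.trans_assoc,
    Path.Homotopic.Quotient.symm_trans, Path.Homotopic.Quotient.refl_trans]

theorem refl_trans_trans_refl_homotopic {Z : Type*} [TopologicalSpace Z] {x y : Z} (p : Path x y) :
    (((Path.refl x).trans p).trans (Path.refl y)).Homotopic p := by
  rw [← Path.Homotopic.Quotient.eq]
  simp [Path.Homotopic.Quotient.refl_trans, Path.Homotopic.Quotient.trans_refl]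

theorem conj_conj_homotopic {Z : Type*} [TopologicalSpace Z] {x₀ x₁ y₀ y₁ : Z}
    (l : Path x₀ y₀) (r : Path x₁ y₁) (p : Path x₀ x₁) :
    ((l.trans ((l.symm.trans p).trans r)).trans r.symm).Homotopic p := by
  rw [← Path.Homotopic.Quotient.eq]
  simp only [Path.Homotopic.Quotient.mk_trans, Path.Homotopic.Quotient.mk_symm,
    Path.Homotopic.Quotient.trans_assoc, Path.Homotopic.Quotient.trans_symm,
    Path.Homotopic.Quotient.trans_refl]
  rw [← Path.Homotopic.Quotient.trans_assoc, Path.Homotopic.Quotient.trans_symm,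
    Path.Homotopic.Quotient.refl_trans]

namespace ArcAttach

variable {A ι Z : Type*} [TopologicalSpace A] [TopologicalSpace ι] [TopologicalSpace Z]

instance (a b : ι → A) : TopologicalSpace (ArcAttach a b) :=
  inferInstanceAs (TopologicalSpace (Quot (ArcRel a b)))

variable {a b : ι → A}

/-- The inclusion of the base space. -/
def incl (a b : ι → A) : C(A, ArcAttach a b) :=
  ⟨fun x => Quot.mk _ (Sum.inl x), continuous_quot_mk.comp continuous_inl⟩

/-- The attached arcs. -/
def arc (a b : ι → A) (k : ι) : Path (incl a b (a k)) (incl a b (b k)) where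
  toFun s := Quot.mk _ (Sum.inr (k, s))
  continuous_toFun := continuous_quot_mk.comp (continuous_inr.comp (by fun_prop))
  source' := Quot.sound (.source k)
  target' := Quot.sound (.target k)

theorem exists_rep (z : ArcAttach a b) :
    (∃ x, incl a b x = z) ∨ ∃ k s, arc a b k s = z := by
  obtain ⟨x | ⟨k, s⟩, rfl⟩ := Quot.exists_rep z
  exacts [Or.inl ⟨x, rfl⟩, Or.inr ⟨k, s, rfl⟩]

theorem map_ext {g g' : C(ArcAttach a b, Z)} (h : ∀ x, g (incl a b x) = g' (incl a b x))
    (h' : ∀ k s, g (arc a b k s) = g' (arc a b k s)) : g = g' := by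
  ext z
  rcases exists_rep z with ⟨x, rfl⟩ | ⟨k, s, rfl⟩
  exacts [h x, h' k s]

variable [DiscreteTopology ι]

/-- The map out of the space with arcs attached defined by a map on the base space and the images
of the arcs. -/
def desc (f : C(A, Z)) (γ : ∀ k, Path (f (a k)) (f (b k))) : C(ArcAttach a b, Z) where
  toFun := Quot.lift (Sum.elim f fun p => γ p.1 p.2) (by
    rintro _ _ (k | k)
    · exact (γ k).source
    · exact (γ k).target)
  continuous_toFun := by
    refine continuous_quot_lift _ (continuous_sum_dom.2 ⟨f.continuous, ?_⟩)
    change Continuous fun p : ι × I => γ p.1 p.2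
    rw [continuous_prod_of_discrete_left]
    exact fun k => (γ k).continuous

/-- A homotopy of maps from the base space together with compatible squares on the arcs gives a
homotopy. -/
theorem homotopic_of_squares {g g' : C(ArcAttach a b, Z)}
    (H : (g.comp (incl a b)).Homotopy (g'.comp (incl a b))) (S : ι → C(I × I, Z))
    (h0 : ∀ k s, S k (s, 0) = H (s, a k)) (h1 : ∀ k s, S k (s, 1) = H (s, b k))
    (hg : ∀ k r, S k (0, r) = g (arc a b k r)) (hg' : ∀ k r, S k (1, r) = g' (arc a b k r)) :
    g.Homotopic g' := by
  -- Homotopies are treated as maps into the path space `C(I, Z)`, so continuity follows from the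
  -- universal property of the quotient and nothing need be known about its product with `I`.
  let f : C(A, C(I, Z)) := ContinuousMap.curry (H.toContinuousMap.comp ContinuousMap.prodSwap)
  let γ : ∀ k, Path (f (a k)) (f (b k)) := fun k =>
    { toContinuousMap := ContinuousMap.curry ((S k).comp ContinuousMap.prodSwap)
      source' := by ext s; exact h0 k s
      target' := by ext s; exact h1 k s }
  refine ⟨{ toContinuousMap := (ContinuousMap.uncurry (desc f γ)).comp ContinuousMap.prodSwap
            map_zero_left := ?_, map_one_left := ?_ }⟩
  · intro z
    rcases exists_rep z with ⟨x, rfl⟩ | ⟨k, s, rfl⟩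
    exacts [H.apply_zero x, hg k s]
  · intro z
    rcases exists_rep z with ⟨x, rfl⟩ | ⟨k, s, rfl⟩
    exacts [H.apply_one x, hg' k s]

theorem desc_homotopic_of_path (f : C(A, Z)) {γ γ' : ∀ k, Path (f (a k)) (f (b k))}
    (h : ∀ k, (γ k).Homotopic (γ' k)) : (desc f γ).Homotopic (desc f γ') :=
  homotopic_of_squares (g := desc f γ) (g' := desc f γ')
    (ContinuousMap.Homotopy.refl _) (fun k => (h k).some.toContinuousMap)
    (fun k s => (h k).some.source s) (fun k s => (h k).some.target s)
    (fun k s => (h k).some.apply_zero s) (fun k s => (h k).some.apply_one s)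

/-- At time `s`, let the arc run back along the track of its source, then along `γ k`, then forward
along the track of its target. At `s = 0` this is `γ k` up to constant paths; at `s = 1` the square
condition makes it homotopic to `γ' k`. -/
theorem desc_homotopic {f f' : C(A, Z)} (H : f.Homotopy f')
    {γ : ∀ k, Path (f (a k)) (f (b k))} {γ' : ∀ k, Path (f' (a k)) (f' (b k))}
    (h : ∀ k, ((H.evalAt (a k)).trans (γ' k)).Homotopic ((γ k).trans (H.evalAt (b k)))) :
    (desc f γ).Homotopic (desc f' γ') := by
  -- The track of `x` under `H` up to time `s`.
  let P (x : A) (s : I) : Path (H (0, x)) (H (s, x)) :=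
    { toFun := fun t => H (s * t, x)
      continuous_toFun := by fun_prop
      source' := by simp
      target' := by simp }
  let C (k : ι) (s : I) : Path (H (s, a k)) (H (s, b k)) :=
    ((P (a k) s).symm.trans ((γ k).cast (H.apply_zero _) (H.apply_zero _))).trans (P (b k) s)
  have hP (x : A) : Continuous ↿(P x) := by
    change Continuous fun p : I × I => H (p.1 * p.2, x)
    fun_prop
  have hC (k : ι) : Continuous ↿(C k) := by
    refine Path.trans_continuous_family _ (Path.trans_continuous_family _ ?_ _ ?_) _ (hP _)
    · exact Path.symm_continuous_family _ (hP _)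
    · exact (γ k).continuous.comp continuous_snd
  let γ₀ k : Path (f (a k)) (f (b k)) := (C k 0).cast (H.apply_zero _).symm (H.apply_zero _).symm
  let γ₁ k : Path (f' (a k)) (f' (b k)) := (C k 1).cast (H.apply_one _).symm (H.apply_one _).symm
  have h₀ : (desc f γ).Homotopic (desc f γ₀) := by
    refine desc_homotopic_of_path f fun k => ?_
    have : γ₀ k = ((Path.refl _).trans (γ k)).trans (Path.refl _) := by
      ext t
      simp [γ₀, C, P, Path.trans_apply]
    rw [this]
    exact (refl_trans_trans_refl_homotopic _).symm
  have h₁ : (desc f' γ₁).Homotopic (desc f' γ') := by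
    refine desc_homotopic_of_path f' fun k => ?_
    have : γ₁ k = ((H.evalAt (a k)).symm.trans (γ k)).trans (H.evalAt (b k)) := by
      ext t
      simp [γ₁, C, P, Path.trans_apply, ContinuousMap.Homotopy.evalAt]
    rw [this]
    exact homotopic_of_trans_homotopic (h k)
  refine h₀.trans (ContinuousMap.Homotopic.trans ?_ h₁)
  exact homotopic_of_squares (g := desc f γ₀) (g' := desc f' γ₁) H (fun k => ⟨_, hC k⟩)
    (fun k s => (C k s).source) (fun k s => (C k s).target) (fun k r => rfl) (fun k r => rfl)

theorem homotopic {g g' : C(ArcAttach a b, Z)}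
    (H : (g.comp (incl a b)).Homotopy (g'.comp (incl a b)))
    (h : ∀ k, ((H.evalAt (a k)).trans ((arc a b k).map g'.continuous)).Homotopic
      (((arc a b k).map g.continuous).trans (H.evalAt (b k)))) : g.Homotopic g' := by
  have := desc_homotopic H h
  convert this using 1 <;> exact map_ext (fun _ => rfl) fun _ _ => rfl

theorem homotopic_of_eq_incl {g g' : C(ArcAttach a b, Z)}
    (H : ∀ x, g (incl a b x) = g' (incl a b x))
    (h : ∀ k, ((arc a b k).map g.continuous).Homotopic
      (((arc a b k).map g'.continuous).cast (H _) (H _))) : g.Homotopic g' := by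
  have := desc_homotopic_of_path (g.comp (incl a b)) h
  convert this using 1 <;> refine map_ext (fun x => ?_) fun _ _ => rfl
  · rfl
  · exact (H x).symm

/-- Moving the endpoints of the arcs along paths does not change the homotopy type. -/
theorem nonempty_homotopyEquiv_of_paths {a' b' : ι → A} (α : ∀ k, Path (a k) (a' k))
    (β : ∀ k, Path (b k) (b' k)) : Nonempty (ArcAttach a b ≃ₕ ArcAttach a' b') := by
  let F : C(ArcAttach a b, ArcAttach a' b') := desc (incl a' b') fun k =>
    (((α k).map (incl a' b').continuous).trans (arc a' b' k)).trans
      ((β k).map (incl a' b').continuous).symm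
  let G : C(ArcAttach a' b', ArcAttach a b) := desc (incl a b) fun k =>
    (((α k).map (incl a b).continuous).symm.trans (arc a b k)).trans
      ((β k).map (incl a b).continuous)
  -- Both composites fix the base space and conjugate each arc by a path and its inverse on either
  -- side, which cancel up to homotopy.
  refine ⟨⟨F, G, ?_, ?_⟩⟩
  · refine homotopic_of_eq_incl (g := G.comp F) (g' := .id _) (fun _ => rfl) fun k => ?_
    have : (arc a b k).map (G.comp F).continuous =
        (((α k).map (incl a b).continuous).trans
          ((((α k).map (incl a b).continuous).symm.trans (arc a b k)).trans
            ((β k).map (incl a b).continuous))).trans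
          ((β k).map (incl a b).continuous).symm := by
      change (((((α k).map (incl a' b').continuous).trans (arc a' b' k)).trans
        ((β k).map (incl a' b').continuous).symm).map G.continuous) = _
      rw [Path.map_trans, Path.map_trans]
      rfl
    rw [this]
    exact conj_conj_homotopic _ _ _
  · refine homotopic_of_eq_incl (g := F.comp G) (g' := .id _) (fun _ => rfl) fun k => ?_
    have : (arc a' b' k).map (F.comp G).continuous =
        (((α k).map (incl a' b').continuous).symm.trans
          ((((α k).map (incl a' b').continuous).symm.symm.trans (arc a' b' k)).trans
            ((β k).map (incl a' b').continuous).symm)).trans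
          ((β k).map (incl a' b').continuous).symm.symm := by
      change (((((α k).map (incl a b).continuous).symm.trans (arc a b k)).trans
        ((β k).map (incl a b).continuous)).map F.continuous) = _
      rw [Path.map_trans, Path.map_trans, Path.symm_symm, Path.symm_symm]
      rfl
    rw [this]
    exact conj_conj_homotopic _ _ _

end ArcAttach

/-! ### Well-pointed spaces -/

/-- A point `y` is nondegenerate if a neighbourhood `{m ≥ 0}` of `y` can be contracted to `y` inside
the ambient space, relative to `y`. -/
def IsNondegenerate {Y : Type*} [TopologicalSpace Y] (y : Y) : Prop :=
  ∃ (ρ : C(Y, Y)) (D : (ContinuousMap.id Y).Homotopy ρ) (m : C(Y, ℝ)),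
    (∀ s, D (s, y) = y) ∧ m y = 1 ∧ ∀ z, 0 ≤ m z → ρ z = y

/-- Homotopy extension at a point. Contracting by `D` first makes `f` constant near `y`; that
neighbourhood can then be dragged along `p`, less and less towards its boundary. The point `y` rests
during the first half, whence the constant path in the conclusion. -/
theorem IsNondegenerate.exists_homotopy {Y Z : Type*} [TopologicalSpace Y] [TopologicalSpace Z]
    {y : Y} (hy : IsNondegenerate y) (f : C(Y, Z)) {z : Z} (p : Path (f y) z) :
    ∃ (f' : C(Y, Z)) (H : f.Homotopy f'), ∀ s, H (s, y) = ((Path.refl (f y)).trans p) s := by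
  obtain ⟨ρ, D, m, hD, hm, hρ⟩ := hy
  have hρy : ρ y = y := hρ y (by simp [hm])
  -- The cutoff `m` slows the motion: at `m = 0` the point stays at `f y`, in agreement with the
  -- other branch, while `y` itself, where `m = 1`, traverses all of `p`. Values above 1 are clamped
  -- by `extend`.
  let q : I × Y → Z := fun x => if m x.2 ≤ 0 then f (ρ x.2) else p.extend (x.1 * m x.2)
  have hq : Continuous q := by
    refine Continuous.if_le (by fun_prop) (by fun_prop) (by fun_prop) (by fun_prop) ?_
    intro x hx
    simp [hx, hρ x.2 hx.ge]
  let H₁ : f.Homotopy (f.comp ρ) := ((ContinuousMap.Homotopy.refl f).comp D).cast (by ext; rfl) rfl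
  let f' : C(Y, Z) := ⟨fun z => q (1, z), by fun_prop⟩
  let H₂ : (f.comp ρ).Homotopy f' :=
    { toFun := q
      continuous_toFun := hq
      map_zero_left := by
        intro x
        by_cases h : m x ≤ 0
        · simp [q, h]
        · simp [q, h, hρ x (not_le.1 h).le]
      map_one_left := fun x => rfl }
  refine ⟨f', H₁.trans H₂, fun s => ?_⟩
  have h₁ (s : I) : H₁ (s, y) = f y := by
    change f (D (s, y)) = f y
    rw [hD]
  have h₂ (s : I) : H₂ (s, y) = p s := by
    change q (s, y) = p s
    simp [q, hm]
  rw [ContinuousMap.Homotopy.trans_apply, Path.trans_apply]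
  split_ifs
  · exact h₁ _
  · exact h₂ _

/-! ### Maps out of the circle -/

/-- The standard parametrization of the circle. -/
noncomputable def circleLoop : Path (1 : Circle) 1 where
  toFun s := Circle.exp (2 * Real.pi * s)
  continuous_toFun := by fun_prop
  source' := by simp
  target' := by simp

theorem isQuotientMap_circleLoop :
    Topology.IsQuotientMap (circleLoop.toContinuousMap) := by
  refine Topology.IsQuotientMap.of_surjective_continuous (fun z => ?_) circleLoop.continuous
  obtain ⟨r, rfl⟩ := Circle.exp_surjective z
  refine ⟨⟨Int.fract (r / (2 * Real.pi)), Int.fract_nonneg _, (Int.fract_lt_one _).le⟩, ?_⟩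
  refine Circle.exp_eq_exp.2 ⟨-⌊r / (2 * Real.pi)⌋, ?_⟩
  have : (2 * Real.pi) ≠ 0 := by positivity
  simp only [Int.fract]
  push_cast
  field_simp
  ring

theorem circleLoop_surjective : Function.Surjective circleLoop :=
  isQuotientMap_circleLoop.surjective

theorem eq_endpoints_of_circleLoop_eq {s r : I} (h : circleLoop s = circleLoop r) (hsr : s < r) :
    s = 0 ∧ r = 1 := by
  obtain ⟨m, hm⟩ := Circle.exp_eq_exp.1 h
  have hs := s.2.1
  have hr := r.2.2
  have hsr' : (s : ℝ) < r := hsr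
  have : (s : ℝ) = r + m := by
    have : (2 * Real.pi) ≠ 0 := by positivity
    exact mul_left_cancel₀ this (by linarith)
  have h1 : (m : ℝ) < 0 := by linarith
  have h2 : -1 ≤ (m : ℝ) := by linarith
  have h3 : m = -1 := by
    have : m < 0 := by exact_mod_cast h1
    have : -1 ≤ m := by exact_mod_cast h2
    omega
  subst h3
  push_cast at this
  constructor <;> apply Subtype.ext
  · change (s : ℝ) = 0
    linarith
  · change (r : ℝ) = 1
    linarith

theorem factorsThrough_circleLoop {Z : Type*} [TopologicalSpace Z] {z z' : Z} (p : Path z z')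
    (h : z' = z) : Function.FactorsThrough p.toContinuousMap circleLoop.toContinuousMap := by
  intro s r hsr
  change p s = p r
  rcases lt_trichotomy s r with hlt | rfl | hlt
  · obtain ⟨rfl, rfl⟩ := eq_endpoints_of_circleLoop_eq hsr hlt
    simp [h]
  · rfl
  · obtain ⟨rfl, rfl⟩ := eq_endpoints_of_circleLoop_eq hsr.symm hlt
    simp [h]

/-- The map out of the circle induced by a loop. -/
noncomputable def circleMap {Z : Type*} [TopologicalSpace Z] {z z' : Z} (p : Path z z')
    (h : z' = z) : C(Circle, Z) :=
  isQuotientMap_circleLoop.lift p.toContinuousMap (factorsThrough_circleLoop p h)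

@[simp] theorem circleMap_circleLoop {Z : Type*} [TopologicalSpace Z] {z z' : Z} (p : Path z z')
    (h : z' = z) (s : I) : circleMap p h (circleLoop s) = p s :=
  ContinuousMap.congr_fun (isQuotientMap_circleLoop.lift_comp p.toContinuousMap
    (factorsThrough_circleLoop p h)) s

@[simp] theorem circleMap_one {Z : Type*} [TopologicalSpace Z] {z z' : Z} (p : Path z z')
    (h : z' = z) : circleMap p h 1 = z := by
  rw [← circleLoop.source, circleMap_circleLoop, p.source]

/-! ### Maps out of a wedge -/

namespace WedgeCircles

variable {X Y Z : Type*} [TopologicalSpace X] [TopologicalSpace Y] [TopologicalSpace Z]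
  (x : X) (y : Y) (n : ℕ)

/-- The inclusion of the first space. -/
def inl : C(X, WedgeCircles x y n) :=
  ⟨fun z => Quot.mk _ (Sum.inl z), continuous_quot_mk.comp continuous_inl⟩

/-- The inclusion of the second space. -/
def inr : C(Y, WedgeCircles x y n) :=
  ⟨fun z => Quot.mk _ (Sum.inr (Sum.inl z)),
    continuous_quot_mk.comp (continuous_inr.comp continuous_inl)⟩

/-- The inclusion of the circles. -/
noncomputable def circle (j : Fin n) : C(Circle, WedgeCircles x y n) :=
  ⟨fun z => Quot.mk _ (Sum.inr (Sum.inr (j, z))),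
    continuous_quot_mk.comp (continuous_inr.comp (continuous_inr.comp (by fun_prop)))⟩

theorem inr_eq : inr x y n y = inl x y n x := Quot.sound ⟨.snd, .fst⟩

theorem circle_one (j : Fin n) : circle x y n j 1 = inl x y n x := Quot.sound ⟨.circle j, .fst⟩

/-- The loops in the wedge given by the circles. -/
noncomputable def loop (j : Fin n) : Path (inl x y n x) (inl x y n x) :=
  (circleLoop.map (circle x y n j).continuous).cast (circle_one x y n j).symm
    (circle_one x y n j).symm

variable {x y n}

theorem exists_rep (z : WedgeCircles x y n) :
    (∃ a, inl x y n a = z) ∨ (∃ b, inr x y n b = z) ∨ ∃ j s, loop x y n j s = z := by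
  obtain ⟨a | b | ⟨j, c⟩, rfl⟩ := Quot.exists_rep z
  · exact Or.inl ⟨a, rfl⟩
  · exact Or.inr (Or.inl ⟨b, rfl⟩)
  · obtain ⟨s, rfl⟩ := circleLoop_surjective c
    exact Or.inr (Or.inr ⟨j, s, rfl⟩)

/-- The map out of the wedge induced by compatible maps. -/
noncomputable def desc (f : C(X, Z)) (g : C(Y, Z)) (c : Fin n → C(Circle, Z)) (hg : g y = f x)
    (hc : ∀ j, c j 1 = f x) : C(WedgeCircles x y n, Z) where
  toFun := Quot.lift (Sum.elim f (Sum.elim g fun p => c p.1 p.2)) (by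
    have key : ∀ u, IsBasePoint x y n u → Sum.elim f (Sum.elim g fun p => c p.1 p.2) u = f x := by
      rintro _ (_ | _ | j)
      exacts [rfl, hg, hc j]
    rintro u u' ⟨h, h'⟩
    rw [key u h, key u' h'])
  continuous_toFun := by
    refine continuous_quot_lift _ (continuous_sum_dom.2 ⟨f.continuous,
      continuous_sum_dom.2 ⟨g.continuous, ?_⟩⟩)
    change Continuous fun p : Fin n × Circle => c p.1 p.2
    rw [continuous_prod_of_discrete_left]
    exact fun j => (c j).continuous

/-- Maps out of the wedge are homotopic if they agree on the first space, are homotopic relative to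
the base point on the second space, and are homotopic on the circles. -/
theorem homotopic {g g' : C(WedgeCircles x y n, Z)} (h₁ : ∀ a, g (inl x y n a) = g' (inl x y n a))
    (H : (g.comp (inr x y n)).Homotopy (g'.comp (inr x y n)))
    (h₂ : ∀ s, H (s, y) = g (inl x y n x))
    (h₃ : ∀ j, ((loop x y n j).map g.continuous).Homotopic
      (((loop x y n j).map g'.continuous).cast (h₁ x) (h₁ x))) : g.Homotopic g' := by
  let f₁ : C(X, C(I, Z)) :=
    ContinuousMap.curry ((g.comp (inl x y n)).comp ContinuousMap.fst)
  let f₂ : C(Y, C(I, Z)) := ContinuousMap.curry (H.toContinuousMap.comp ContinuousMap.prodSwap)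
  let Θ j := (h₃ j).some
  let q (j : Fin n) : Path (f₁ x) (f₁ x) :=
    { toContinuousMap := ContinuousMap.curry ((Θ j).toContinuousMap.comp ContinuousMap.prodSwap)
      source' := by ext s; exact (Θ j).source s
      target' := by ext s; exact (Θ j).target s }
  let h : C(WedgeCircles x y n, C(I, Z)) := desc f₁ f₂ (fun j => circleMap (q j) rfl)
    (by ext s; exact h₂ s) (fun j => circleMap_one _ _)
  have hh (j s) : h (loop x y n j s) = q j s := circleMap_circleLoop (q j) rfl s
  refine ⟨{ toContinuousMap := (ContinuousMap.uncurry h).comp ContinuousMap.prodSwap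
            map_zero_left := ?_, map_one_left := ?_ }⟩
  · intro z
    change h z 0 = _
    rcases exists_rep z with ⟨a, rfl⟩ | ⟨b, rfl⟩ | ⟨j, s, rfl⟩
    · rfl
    · exact H.apply_zero b
    · rw [hh]
      exact (Θ j).apply_zero s
  · intro z
    change h z 1 = _
    rcases exists_rep z with ⟨a, rfl⟩ | ⟨b, rfl⟩ | ⟨j, s, rfl⟩
    · exact h₁ a
    · exact H.apply_one b
    · rw [hh]
      exact (Θ j).apply_one s

end WedgeCircles

/-! ### Contracting an arc to obtain a wedge -/

/-- Homotopies on the two parts of a disjoint union. -/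
def sumHomotopy {X Y Z : Type*} [TopologicalSpace X] [TopologicalSpace Y] [TopologicalSpace Z]
    {f g : C(X ⊕ Y, Z)}
    (H₁ : (f.comp ⟨Sum.inl, continuous_inl⟩).Homotopy (g.comp ⟨Sum.inl, continuous_inl⟩))
    (H₂ : (f.comp ⟨Sum.inr, continuous_inr⟩).Homotopy (g.comp ⟨Sum.inr, continuous_inr⟩)) :
    f.Homotopy g where
  toFun p := Sum.elim (fun u => H₁ (p.1, u)) (fun u => H₂ (p.1, u)) p.2
  continuous_toFun := by
    let h : C(X ⊕ Y, C(I, Z)) :=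
      ⟨Sum.elim (ContinuousMap.curry (H₁.toContinuousMap.comp ContinuousMap.prodSwap))
        (ContinuousMap.curry (H₂.toContinuousMap.comp ContinuousMap.prodSwap)),
        continuous_sum_dom.2 ⟨ContinuousMap.continuous _, ContinuousMap.continuous _⟩⟩
    convert ((ContinuousMap.uncurry h).comp ContinuousMap.prodSwap).continuous using 1
    ext ⟨s, u | u⟩ <;> rfl
  map_zero_left := by
    rintro (u | u)
    exacts [H₁.apply_zero u, H₂.apply_zero u]
  map_one_left := by
    rintro (u | u)
    exacts [H₁.apply_one u, H₂.apply_one u]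

/-- This and the next lemma are the square conditions of `ArcAttach.homotopic` for the contracted
arc and for the remaining arcs, respectively. -/
theorem refl_trans_homotopic_refl_trans_cast {Z : Type*} [TopologicalSpace Z] {u v w : Z}
    {p : Path u v} {q : Path v u} (hq : q.Homotopic p.symm) (hw : w = u) :
    ((Path.refl u).trans p).Homotopic
      (((Path.refl u).cast rfl hw).trans (q.symm.cast hw rfl)) := by
  subst hw
  have := hq.symm₂
  rw [Path.symm_symm] at this
  exact Path.Homotopic.hcomp (Path.Homotopic.refl _) this.symm

theorem refl_trans_homotopic_trans_trans_cast {Z : Type*} [TopologicalSpace Z] {u v w : Z}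
    (p : Path u v) (q : Path v u) (hw : w = u) :
    ((Path.refl u).trans p).Homotopic
      (((p.trans q).cast rfl hw).trans (q.symm.cast hw rfl)) := by
  subst hw
  rw [← Path.Homotopic.Quotient.eq]
  simp [Path.Homotopic.Quotient.trans_assoc, Path.Homotopic.Quotient.refl_trans,
    Path.Homotopic.Quotient.trans_refl, Path.Homotopic.Quotient.trans_symm]

/-- Contracting one of `n + 1` arcs joining a point of `X` to a nondegenerate point of `Y` yields
a wedge. -/
theorem nonempty_arcAttach_homotopyEquiv_wedgeCircles {X Y : Type*} [TopologicalSpace X]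
    [TopologicalSpace Y] (x : X) (y : Y) (hy : IsNondegenerate y) (n : ℕ) :
    Nonempty (ArcAttach (fun _ : Fin (n + 1) => (Sum.inl x : X ⊕ Y)) (fun _ => Sum.inr y) ≃ₕ
      WedgeCircles x y n) := by
  set a : Fin (n + 1) → X ⊕ Y := fun _ => Sum.inl x
  set b : Fin (n + 1) → X ⊕ Y := fun _ => Sum.inr y
  let iX : C(X, X ⊕ Y) := ⟨Sum.inl, continuous_inl⟩
  let iY : C(Y, X ⊕ Y) := ⟨Sum.inr, continuous_inr⟩
  let arc := ArcAttach.arc a b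
  let incl := ArcAttach.incl a b
  -- The inclusion of `Y` is deformed so that `y` travels back along arc 0 to `x`; only then does it
  -- fit together with the inclusion of `X` to a map from the wedge.
  obtain ⟨f', H, hH⟩ := hy.exists_homotopy (incl.comp iY) (arc 0).symm
  have hf' : f' y = incl (Sum.inl x) := by
    rw [← H.apply_one, hH, Path.target]
  let P : Path (incl (Sum.inr y)) (incl (Sum.inl x)) := (H.evalAt y).cast rfl hf'.symm
  have hP : P = (Path.refl _).trans (arc 0).symm := by
    ext s
    exact hH s
  let G : C(WedgeCircles x y n, ArcAttach a b) := WedgeCircles.desc (incl.comp iX) f'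
    (fun j => circleMap ((arc j.succ).trans P) rfl) hf' (fun j => circleMap_one _ _)
  have hGl (j s) : G (WedgeCircles.loop x y n j s) = ((arc j.succ).trans P) s :=
    circleMap_circleLoop ((arc j.succ).trans P) rfl s
  let i : C(X ⊕ Y, WedgeCircles x y n) :=
    ⟨Sum.elim (WedgeCircles.inl x y n) (WedgeCircles.inr x y n),
      continuous_sum_dom.2 ⟨ContinuousMap.continuous _, ContinuousMap.continuous _⟩⟩
  have hxy : i (Sum.inr y) = i (Sum.inl x) := WedgeCircles.inr_eq x y n
  -- Arc 0 is crushed to the base point and arc `j + 1` becomes the `j`-th circle.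
  let q : ∀ k : Fin (n + 1), Path (i (a k)) (i (b k)) := fun k =>
    Fin.cases ((Path.refl (i (Sum.inl x))).cast rfl hxy)
      (fun j => (WedgeCircles.loop x y n j).cast rfl hxy) k
  let F : C(ArcAttach a b, WedgeCircles x y n) := ArcAttach.desc i q
  have hF0 (s) : F (arc 0 s) = WedgeCircles.inl x y n x := rfl
  have hFP (s) : F (P s) = WedgeCircles.inl x y n x := by
    rw [hP, Path.trans_apply]
    split_ifs
    · exact hxy
    · exact hF0 _
  refine ⟨⟨F, G, ?_, ?_⟩⟩
  · let HA : ((G.comp F).comp incl).Homotopy ((ContinuousMap.id _).comp incl) :=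
      sumHomotopy (ContinuousMap.Homotopy.refl _) H.symm
    refine ArcAttach.homotopic HA fun k => ?_
    have h₁ : HA.evalAt (a k) = Path.refl (incl (Sum.inl x)) := rfl
    have h₂ : HA.evalAt (b k) = P.symm.cast hf' rfl := rfl
    rw [h₁, h₂]
    refine Fin.cases ?_ (fun j => ?_) k
    · have : (ArcAttach.arc a b 0).map (G.comp F).continuous = (Path.refl _).cast rfl hf' := by
        ext s
        rfl
      rw [this]
      refine refl_trans_homotopic_refl_trans_cast (p := arc 0) ?_ hf'
      rw [hP, ← Path.Homotopic.Quotient.eq]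
      simp [Path.Homotopic.Quotient.refl_trans]
    · have : (ArcAttach.arc a b j.succ).map (G.comp F).continuous =
          ((arc j.succ).trans P).cast rfl hf' := by
        ext s
        exact hGl j s
      rw [this]
      exact refl_trans_homotopic_trans_trans_cast (arc j.succ) P hf'
  -- The track of `y` is the image under `F` of arc 0 reversed. Since `F` crushes that arc, the
  -- homotopy is relative to the base point.
  · let HY : ((F.comp G).comp (WedgeCircles.inr x y n)).Homotopy
        ((ContinuousMap.id _).comp (WedgeCircles.inr x y n)) :=
      ((ContinuousMap.Homotopy.refl F).comp H).symm
    refine WedgeCircles.homotopic (fun _ => rfl) HY (fun s => hFP _) fun j => ?_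
    have : (WedgeCircles.loop x y n j).map (F.comp G).continuous =
        (WedgeCircles.loop x y n j).trans (Path.refl _) := by
      ext s
      change F (G (WedgeCircles.loop x y n j s)) = _
      rw [hGl, Path.trans_apply]
      refine Eq.trans ?_
        (Path.trans_apply (WedgeCircles.loop x y n j) (Path.refl (WedgeCircles.inl x y n x)) s).symm
      split_ifs
      · rfl
      · exact hFP _
    rw [this]
    exact ⟨Path.Homotopy.transRefl (WedgeCircles.loop x y n j)⟩

/-! ### Replacing convex bridges by arcs -/

/-- Two spaces `A₁` and `A₂` joined by convex bridges `J k` inside a vector space. On each bridge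
`lam k` measures the progress from `A₁` to `A₂`; the first third of the bridge is mapped to `A₁` and
the last third to `A₂`, and the middle third will be mapped to an arc. -/
structure BridgeData (E A₁ A₂ κ : Type*) [AddCommGroup E] [Module ℝ E] [TopologicalSpace E]
    [TopologicalSpace A₁] [TopologicalSpace A₂] (S : Set E) where
  j₁ : C(A₁, E)
  j₂ : C(A₂, E)
  J : κ → Set E
  lam : κ → C(E, ℝ)
  a : κ → A₁
  b : κ → A₂
  ρ₁ : ∀ k, C(J k, A₁)
  ρ₂ : ∀ k, C(J k, A₂)
  j₁_injective : Function.Injective j₁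
  j₂_injective : Function.Injective j₂
  j₁_ne_j₂ : ∀ x y, j₁ x ≠ j₂ y
  j₁_mem : ∀ x, j₁ x ∈ S
  j₂_mem : ∀ y, j₂ y ∈ S
  J_subset : ∀ k, J k ⊆ S
  J_isClosed : ∀ k, IsClosed (J k)
  J_convex : ∀ k, Convex ℝ (J k)
  exists_of_mem : ∀ p ∈ S, (∃ x, j₁ x = p) ∨ (∃ y, j₂ y = p) ∨ ∃ k, p ∈ J k
  exists_of_mem_J : ∀ k l, k ≠ l → ∀ p, p ∈ J k → p ∈ J l → (∃ x, j₁ x = p) ∨ (∃ y, j₂ y = p)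
  lam_j₁ : ∀ k x, j₁ x ∈ J k → lam k (j₁ x) = 0
  lam_j₂ : ∀ k y, j₂ y ∈ J k → lam k (j₂ y) = 1
  ρ₁_j₁ : ∀ k x (h : j₁ x ∈ J k), ρ₁ k ⟨j₁ x, h⟩ = x
  ρ₂_j₂ : ∀ k y (h : j₂ y ∈ J k), ρ₂ k ⟨j₂ y, h⟩ = y
  j₁_ρ₁_mem : ∀ k p, j₁ (ρ₁ k p) ∈ J k
  j₂_ρ₂_mem : ∀ k p, j₂ (ρ₂ k p) ∈ J k
  ρ₁_eq : ∀ k (p : J k), 1 / 3 ≤ lam k p → ρ₁ k p = a k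
  ρ₂_eq : ∀ k (p : J k), lam k p ≤ 2 / 3 → ρ₂ k p = b k
  a_mem : ∀ k, j₁ (a k) ∈ J k
  b_mem : ∀ k, j₂ (b k) ∈ J k
  lam_segment : ∀ k (s : ℝ), s ∈ I → lam k ((1 - s) • j₁ (a k) + s • j₂ (b k)) = s
  ρ₁_segment : ∀ k (p : J k) (s : ℝ), s ∈ I → (p : E) = (1 - s) • j₁ (a k) + s • j₂ (b k) →
    ρ₁ k p = a k
  ρ₂_segment : ∀ k (p : J k) (s : ℝ), s ∈ I → (p : E) = (1 - s) • j₁ (a k) + s • j₂ (b k) →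
    ρ₂ k p = b k

namespace BridgeData

variable {E A₁ A₂ κ : Type*} [AddCommGroup E] [Module ℝ E] [TopologicalSpace E]
  [TopologicalSpace A₁] [TopologicalSpace A₂] {S : Set E}
  (B : BridgeData E A₁ A₂ κ S)

/-- The space with one arc for every bridge. -/
abbrev Arcs : Type _ :=
  ArcAttach (fun k => (Sum.inl (B.a k) : A₁ ⊕ A₂)) (fun k => Sum.inr (B.b k))

theorem segment_mem (k : κ) {s : ℝ} (hs : s ∈ I) :
    (1 - s) • B.j₁ (B.a k) + s • B.j₂ (B.b k) ∈ B.J k :=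
  B.J_convex k (B.a_mem k) (B.b_mem k) (by linarith [hs.2]) hs.1 (by ring)

/-- The pieces covering the space. -/
def cover : A₁ ⊕ A₂ ⊕ (Σ k, B.J k) → S
  | .inl x => ⟨B.j₁ x, B.j₁_mem x⟩
  | .inr (.inl y) => ⟨B.j₂ y, B.j₂_mem y⟩
  | .inr (.inr p) => ⟨p.2, B.J_subset _ p.2.2⟩

theorem continuous_cover : Continuous B.cover := by
  refine continuous_sum_dom.2 ⟨?_, continuous_sum_dom.2 ⟨?_, continuous_sigma fun k => ?_⟩⟩
  · exact B.j₁.continuous.subtype_mk _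
  · exact B.j₂.continuous.subtype_mk _
  · exact continuous_subtype_val.subtype_mk _

theorem cover_surjective : Function.Surjective B.cover := by
  rintro ⟨p, hp⟩
  obtain ⟨x, rfl⟩ | ⟨y, rfl⟩ | ⟨k, hk⟩ := B.exists_of_mem p hp
  exacts [⟨.inl x, rfl⟩, ⟨.inr (.inl y), rfl⟩, ⟨.inr (.inr ⟨k, p, hk⟩), rfl⟩]

variable [TopologicalSpace κ]

open Classical in
/-- The map from a bridge to the corresponding arc. -/
noncomputable def bridgeMap (k : κ) (p : B.J k) : B.Arcs :=
  if B.lam k p ≤ 1 / 3 then ArcAttach.incl _ _ (Sum.inl (B.ρ₁ k p))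
  else if B.lam k p ≤ 2 / 3 then (ArcAttach.arc _ _ k).extend (3 * B.lam k p - 1)
  else ArcAttach.incl _ _ (Sum.inr (B.ρ₂ k p))

theorem continuous_bridgeMap (k : κ) : Continuous (B.bridgeMap k) := by
  refine Continuous.if_le (by fun_prop) (Continuous.if_le (by fun_prop) (by fun_prop)
    (by fun_prop) (by fun_prop) ?_) (by fun_prop) (by fun_prop) ?_
  · intro p hp
    rw [hp, B.ρ₂_eq k p hp.le, Path.extend_of_one_le _ (by norm_num)]
  · intro p hp
    rw [hp, if_pos (by norm_num), B.ρ₁_eq k p hp.ge, Path.extend_of_le_zero _ (by norm_num)]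

theorem bridgeMap_of_eq_j₁ (k : κ) (p : B.J k) (x : A₁) (h : B.j₁ x = p) :
    B.bridgeMap k p = ArcAttach.incl _ _ (Sum.inl x) := by
  obtain ⟨p, hp⟩ := p
  obtain rfl : B.j₁ x = p := h
  rw [bridgeMap, if_pos (by rw [B.lam_j₁ k x hp]; norm_num), B.ρ₁_j₁]

theorem bridgeMap_of_eq_j₂ (k : κ) (p : B.J k) (y : A₂) (h : B.j₂ y = p) :
    B.bridgeMap k p = ArcAttach.incl _ _ (Sum.inr y) := by
  obtain ⟨p, hp⟩ := p
  obtain rfl : B.j₂ y = p := h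
  rw [bridgeMap, if_neg (by rw [B.lam_j₂ k y hp]; norm_num),
    if_neg (by rw [B.lam_j₂ k y hp]; norm_num), B.ρ₂_j₂]

theorem bridgeMap_segment (k : κ) (p : B.J k) (s : I)
    (h : (p : E) = (1 - s : ℝ) • B.j₁ (B.a k) + (s : ℝ) • B.j₂ (B.b k)) :
    B.bridgeMap k p = (ArcAttach.arc _ _ k).extend (3 * (s : ℝ) - 1) := by
  have hl : B.lam k p = s := by rw [h, B.lam_segment k s s.2]
  rw [bridgeMap, hl, B.ρ₁_segment k p s s.2 h, B.ρ₂_segment k p s s.2 h]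
  split_ifs with h₁ h₂
  · rw [Path.extend_of_le_zero _ (by linarith)]
  · rfl
  · rw [Path.extend_of_one_le _ (by linarith)]

/-- The map to the space with arcs on the pieces. -/
noncomputable def coverMap : A₁ ⊕ A₂ ⊕ (Σ k, B.J k) → B.Arcs
  | .inl x => ArcAttach.incl _ _ (Sum.inl x)
  | .inr (.inl y) => ArcAttach.incl _ _ (Sum.inr y)
  | .inr (.inr p) => B.bridgeMap p.1 p.2

theorem coverMap_of_eq_j₁ (u : A₁ ⊕ A₂ ⊕ (Σ k, B.J k)) (x : A₁) (h : B.j₁ x = B.cover u) :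
    B.coverMap u = ArcAttach.incl _ _ (Sum.inl x) := by
  obtain x' | y | p := u
  · rw [B.j₁_injective h]
    rfl
  · exact (B.j₁_ne_j₂ _ _ h).elim
  · exact B.bridgeMap_of_eq_j₁ _ _ _ h

theorem coverMap_of_eq_j₂ (u : A₁ ⊕ A₂ ⊕ (Σ k, B.J k)) (y : A₂) (h : B.j₂ y = B.cover u) :
    B.coverMap u = ArcAttach.incl _ _ (Sum.inr y) := by
  obtain x | y' | p := u
  · exact (B.j₁_ne_j₂ _ _ h.symm).elim
  · rw [B.j₂_injective h]
    rfl
  · exact B.bridgeMap_of_eq_j₂ _ _ _ h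

/-- A point in two different pieces lies in `A₁` or `A₂`, and there every piece is forced to use the
inclusion. -/
theorem coverMap_factorsThrough : Function.FactorsThrough B.coverMap B.cover := by
  intro u u' h
  obtain x | y | ⟨k, p⟩ := u
  · exact (B.coverMap_of_eq_j₁ u' x (congrArg Subtype.val h)).symm
  · exact (B.coverMap_of_eq_j₂ u' y (congrArg Subtype.val h)).symm
  obtain x | y | ⟨l, p'⟩ := u'
  · exact B.coverMap_of_eq_j₁ _ x (congrArg Subtype.val h).symm
  · exact B.coverMap_of_eq_j₂ _ y (congrArg Subtype.val h).symm
  have hp : (p : E) = p' := congrArg Subtype.val h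
  by_cases hkl : k = l
  · subst hkl
    rw [Subtype.ext hp]
  · obtain ⟨x, hx⟩ | ⟨y, hy⟩ := B.exists_of_mem_J k l hkl p p.2 (hp ▸ p'.2)
    · rw [B.coverMap_of_eq_j₁ (.inr (.inr ⟨k, p⟩)) x hx,
        B.coverMap_of_eq_j₁ (.inr (.inr ⟨l, p'⟩)) x (hx.trans hp)]
    · rw [B.coverMap_of_eq_j₂ (.inr (.inr ⟨k, p⟩)) y hy,
        B.coverMap_of_eq_j₂ (.inr (.inr ⟨l, p'⟩)) y (hy.trans hp)]

variable [DiscreteTopology κ]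

theorem continuous_coverMap : Continuous B.coverMap := by
  refine continuous_sum_dom.2 ⟨?_, continuous_sum_dom.2 ⟨?_, continuous_sigma fun k => ?_⟩⟩
  · exact (ContinuousMap.continuous _).comp continuous_inl
  · exact (ContinuousMap.continuous _).comp continuous_inr
  · exact B.continuous_bridgeMap k

variable [ContinuousAdd E] [ContinuousSMul ℝ E]

/-- The map sending the arcs to segments in the bridges. -/
noncomputable def ofArcs : C(B.Arcs, S) :=
  ArcAttach.desc
    ⟨Sum.elim (fun x => ⟨B.j₁ x, B.j₁_mem x⟩) (fun y => ⟨B.j₂ y, B.j₂_mem y⟩),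
      continuous_sum_dom.2 ⟨B.j₁.continuous.subtype_mk _, B.j₂.continuous.subtype_mk _⟩⟩
    fun k =>
      { toFun := fun s => ⟨(1 - s : ℝ) • B.j₁ (B.a k) + (s : ℝ) • B.j₂ (B.b k),
          B.J_subset k (B.segment_mem k s.2)⟩
        continuous_toFun := by fun_prop
        source' := by ext; simp
        target' := by ext; simp }

/-- Each bridge is carried into itself, so by convexity the straight-line homotopy to the identity
stays in `S`. -/
theorem ofArcs_bridgeMap_mem (k : κ) (p : B.J k) : (B.ofArcs (B.bridgeMap k p) : E) ∈ B.J k := by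
  rw [bridgeMap]
  split_ifs
  · exact B.j₁_ρ₁_mem k p
  · exact B.segment_mem k (Set.projIcc 0 1 zero_le_one _).2
  · exact B.j₂_ρ₂_mem k p

variable [Finite κ] [CompactSpace A₁] [CompactSpace A₂] [CompactSpace S] [T2Space E]

/-- Finitely many compact pieces map onto a Hausdorff space. -/
theorem isQuotientMap_cover :
    Topology.IsQuotientMap (⟨B.cover, B.continuous_cover⟩ : C(A₁ ⊕ A₂ ⊕ (Σ k, B.J k), S)) := by
  have (k : κ) : CompactSpace (B.J k) := by
    rw [← isCompact_iff_compactSpace]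
    exact (isCompact_iff_compactSpace.2 ‹CompactSpace S›).of_isClosed_subset (B.J_isClosed k)
      (B.J_subset k)
  exact Topology.IsQuotientMap.of_surjective_continuous B.cover_surjective B.continuous_cover

/-- The map collapsing the bridges to arcs. -/
noncomputable def toArcs : C(S, B.Arcs) :=
  B.isQuotientMap_cover.lift ⟨B.coverMap, B.continuous_coverMap⟩ B.coverMap_factorsThrough

theorem toArcs_cover (u : A₁ ⊕ A₂ ⊕ (Σ k, B.J k)) : B.toArcs (B.cover u) = B.coverMap u :=
  ContinuousMap.congr_fun (B.isQuotientMap_cover.lift_comp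
    ⟨B.coverMap, B.continuous_coverMap⟩ B.coverMap_factorsThrough) u

theorem segment_ofArcs_toArcs_subset (p : S) (s : I) :
    (1 - s : ℝ) • (B.ofArcs (B.toArcs p) : E) + (s : ℝ) • (p : E) ∈ S := by
  obtain ⟨x | y | ⟨k, p⟩, rfl⟩ := B.cover_surjective p
  · rw [toArcs_cover]
    change (1 - s : ℝ) • B.j₁ x + (s : ℝ) • B.j₁ x ∈ S
    rw [← add_smul, sub_add_cancel, one_smul]
    exact B.j₁_mem x
  · rw [toArcs_cover]
    change (1 - s : ℝ) • B.j₂ y + (s : ℝ) • B.j₂ y ∈ S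
    rw [← add_smul, sub_add_cancel, one_smul]
    exact B.j₂_mem y
  · rw [toArcs_cover]
    exact B.J_subset k (B.J_convex k (B.ofArcs_bridgeMap_mem k p) p.2 (by linarith [s.2.2])
      s.2.1 (by ring))

/-- Convex bridges may be replaced by arcs. -/
noncomputable def homotopyEquivArcs : S ≃ₕ B.Arcs where
  toFun := B.toArcs
  invFun := B.ofArcs
  left_inv := ⟨{
    toFun := fun q => ⟨_, B.segment_ofArcs_toArcs_subset q.2 q.1⟩
    continuous_toFun := by fun_prop
    map_zero_left := fun p => by ext; simp
    map_one_left := fun p => by ext; simp }⟩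
  right_inv := by
    have hincl (x : A₁ ⊕ A₂) : (B.toArcs.comp B.ofArcs) (ArcAttach.incl _ _ x) =
        (ContinuousMap.id _) (ArcAttach.incl _ _ x) := by
      obtain x | y := x
      · exact B.toArcs_cover (.inl x)
      · exact B.toArcs_cover (.inr (.inl y))
    refine ArcAttach.homotopic_of_eq_incl hincl fun k => ?_
    -- On an arc the composite waits during the outer thirds and runs at triple speed in between: a
    -- reparametrization.
    let φ : I → I := fun s => Set.projIcc 0 1 zero_le_one (3 * (s : ℝ) - 1)
    have hφ : Continuous φ := by fun_prop
    have hφ₀ : φ 0 = 0 := Set.projIcc_of_le_left _ (by simp)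
    have hφ₁ : φ 1 = 1 := Set.projIcc_of_right_le _ (by norm_num)
    have h : (ArcAttach.arc _ _ k).map (B.toArcs.comp B.ofArcs).continuous =
        ((ArcAttach.arc _ _ k).reparam φ hφ hφ₀ hφ₁).cast (hincl _) (hincl _) := by
      ext s
      exact (B.toArcs_cover (.inr (.inr ⟨k, _, B.segment_mem k s.2⟩))).trans
        (B.bridgeMap_segment k _ s rfl)
    rw [h]
    exact Path.Homotopic.pathCast ⟨(Path.Homotopy.reparam _ φ hφ hφ₀ hφ₁).symm⟩ (hincl _) (hincl _)

end BridgeData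

/-! ### Hom complexes -/

section General

variable {W V : Type*} [Fintype V] {T : SimpleGraph W} {G : SimpleGraph V}

/-- The supports of the coordinates of `p` form the smallest cell whose closure contains `p`. -/
theorem mem_homComplex_iff {p : W → V → ℝ} :
    p ∈ homComplex T G ↔ (∀ x, p x ∈ stdSimplex ℝ V) ∧
      ∀ x y, T.Adj x y → ∀ a b, p x a ≠ 0 → p y b ≠ 0 → G.Adj a b := by
  simp only [homComplex, Set.mem_iUnion, exists_prop]
  constructor
  · rintro ⟨τ, ⟨-, hτ⟩, hp⟩
    refine ⟨fun x => (hp x).1, fun x y hxy a b ha hb => hτ x y hxy a ?_ b ?_⟩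
    · by_contra h
      exact ha ((hp x).2 a h)
    · by_contra h
      exact hb ((hp y).2 b h)
  · rintro ⟨h₁, h₂⟩
    refine ⟨fun x => {a | p x a ≠ 0}, ⟨fun x => ?_, fun x y hxy a ha b hb => h₂ x y hxy a b ha hb⟩,
      fun x => ⟨h₁ x, fun a ha => not_not.1 ha⟩⟩
    by_contra h
    rw [Set.not_nonempty_iff_eq_empty, Set.eq_empty_iff_forall_notMem] at h
    have h0 (a : V) : p x a = 0 := not_not.1 (h a)
    have := (h₁ x).2
    simp [h0] at this

theorem mem_homComplex_of_support {p q : W → V → ℝ} (hp : p ∈ homComplex T G)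
    (hq : ∀ x, q x ∈ stdSimplex ℝ V) (h : ∀ x a, q x a ≠ 0 → p x a ≠ 0) :
    q ∈ homComplex T G := by
  rw [mem_homComplex_iff] at hp ⊢
  exact ⟨hq, fun x y hxy a b ha hb => hp.2 x y hxy a b (h x a ha) (h y b hb)⟩

theorem combo_mem_homComplex {p q : W → V → ℝ} (hp : p ∈ homComplex T G)
    (hq : ∀ x, q x ∈ stdSimplex ℝ V) (h : ∀ x a, q x a ≠ 0 → p x a ≠ 0) {s : ℝ} (hs : s ∈ I) :
    (1 - s) • q + s • p ∈ homComplex T G := by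
  refine mem_homComplex_of_support hp (fun x => ?_) fun x a hxa => ?_
  · exact convex_stdSimplex ℝ V (hq x) ((mem_homComplex_iff.1 hp).1 x) (by linarith [hs.2]) hs.1
      (by ring)
  · intro h0
    have : q x a = 0 := by
      by_contra h1
      exact h x a h1 h0
    simp [h0, this] at hxa

theorem isCompact_homComplex [Finite W] : IsCompact (homComplex T G) := by
  have hc : IsCompact {p : W → V → ℝ | ∀ x, p x ∈ stdSimplex ℝ V} := by
    have := isCompact_univ_pi fun _ : W => isCompact_stdSimplex ℝ V
    simpa [Set.pi] using this
  refine hc.of_isClosed_subset ?_ fun p hp => (mem_homComplex_iff.1 hp).1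
  refine Set.Finite.isClosed_biUnion (Set.toFinite _) fun τ _ => ?_
  have : closedCell τ = {p : W → V → ℝ | ∀ x, p x ∈ stdSimplex ℝ V} ∩
      ⋂ x, ⋂ a, ⋂ (_ : a ∉ τ x), {p | p x a = 0} := by
    ext p
    simp [closedCell, forall_and]
  rw [this]
  refine hc.isClosed.inter (isClosed_iInter fun x => isClosed_iInter fun a =>
    isClosed_iInter fun _ => isClosed_eq ?_ continuous_const)
  exact (continuous_apply a).comp (continuous_apply x)

instance [Finite W] : CompactSpace (homComplex T G) :=
  isCompact_iff_compactSpace.1 isCompact_homComplex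

/-- Every point of a Hom complex is nondegenerate: it has a star-shaped neighbourhood. -/
theorem isNondegenerate_homComplex [Fintype W] (y : homComplex T G) : IsNondegenerate y := by
  -- Near `y` the coordinates that are nonzero at `y` remain nonzero, so the segment from `y` to
  -- such a `z` lies in a closed cell containing `z`.
  have hU : {z : W → V → ℝ | ∀ x a, y.1 x a ≠ 0 → z x a ≠ 0} ∈ nhds y.1 := by
    simp only [Set.ofPred_forall]
    refine Filter.iInter_mem.2 fun x => Filter.iInter_mem.2 fun a => Filter.iInter_mem.2 fun h => ?_
    have hc : Continuous fun z : W → V → ℝ => z x a :=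
      (continuous_apply a).comp (continuous_apply x)
    exact (hc.isOpen_preimage _ isOpen_ne).mem_nhds h
  obtain ⟨ε, hε, hball⟩ := Metric.mem_nhds_iff.1 hU
  -- Here `m` is 1 at `y`, 0 at distance `ε / 2` and at most `-1` from distance `ε` on. So `c` rises
  -- from 0 to 1 between these radii, and `θ` contracts the inner ball to `y` while fixing
  -- everything outside the outer one.
  let m : C(homComplex T G, ℝ) := ⟨fun z => 1 - 2 * dist z.1 y.1 / ε, by fun_prop⟩
  let c : homComplex T G → I := fun z => Set.projIcc 0 1 zero_le_one (-m z)
  have hc : Continuous c := by fun_prop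
  let θ : I → homComplex T G → ℝ := fun s z => 1 - s + s * c z
  have hθ (s z) : θ s z ∈ I := by
    have h₁ := s.2.1
    have h₂ := s.2.2
    have h₃ := (c z).2.1
    have h₄ := (c z).2.2
    constructor
    · have := mul_nonneg h₁ h₃
      simp only [θ]
      linarith
    · have := mul_le_mul_of_nonneg_left h₄ h₁
      simp only [θ]
      linarith
  have hmem (s : I) (z : homComplex T G) :
      (1 - θ s z) • y.1 + θ s z • z.1 ∈ homComplex T G := by
    by_cases hz : dist z.1 y.1 < ε
    · exact combo_mem_homComplex z.2 (mem_homComplex_iff.1 y.2).1 (hball hz) (hθ s z)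
    · have h : c z = 1 := by
        refine Set.projIcc_of_right_le _ ?_
        have : 1 ≤ dist z.1 y.1 / ε := (one_le_div hε).2 (not_lt.1 hz)
        simp only [m, ContinuousMap.coe_mk]
        rw [mul_div_assoc]
        linarith
      have : θ s z = 1 := by simp [θ, h]
      rw [this]
      simp
  refine ⟨⟨fun z => ⟨_, hmem 1 z⟩, by fun_prop⟩,
    { toFun := fun q => ⟨_, hmem q.1 q.2⟩
      continuous_toFun := by fun_prop
      map_zero_left := fun z => by ext; simp [θ]
      map_one_left := fun z => rfl }, m, fun s => ?_, by simp [m], fun z hz => ?_⟩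
  · ext1
    change (1 - θ s y) • y.1 + θ s y • y.1 = y.1
    rw [← add_smul, sub_add_cancel, one_smul]
  · ext1
    have h : c z = 0 := Set.projIcc_of_le_left _ (by linarith)
    change (1 - θ 1 z) • y.1 + θ 1 z • z.1 = y.1
    simp [θ, h]

theorem joinedIn_of_support {p q : W → V → ℝ} (hp : p ∈ homComplex T G)
    (hq : ∀ x, q x ∈ stdSimplex ℝ V) (h : ∀ x a, q x a ≠ 0 → p x a ≠ 0) :
    JoinedIn (homComplex T G) q p := by
  refine JoinedIn.of_segment_subset ?_
  rw [segment_eq_image]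
  rintro _ ⟨s, hs, rfl⟩
  exact combo_mem_homComplex hp hq h hs

end General

/-! ### Path-connectedness of `Hom(K₂, G)` -/

section EdgeComplex

variable {V : Type*} [Fintype V] [DecidableEq V] {G : SimpleGraph V}

/-- The vertex of `Hom(K₂, G)` given by an oriented edge, the `c`-th coordinate being `u`. -/
def edgeVertex (c : Fin 2) (u v : V) : Fin 2 → V → ℝ :=
  fun x => if x = c then Pi.single u 1 else Pi.single v 1

theorem edgeVertex_rev (c : Fin 2) (u v : V) : edgeVertex c.rev u v = edgeVertex c v u := by
  funext x
  fin_cases c <;> fin_cases x <;> rfl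

theorem edgeVertex_mem_stdSimplex (c : Fin 2) (u v : V) (x : Fin 2) :
    edgeVertex c u v x ∈ stdSimplex ℝ V := by
  unfold edgeVertex
  split_ifs <;> exact single_mem_stdSimplex ℝ _

theorem mem_homComplex_K2 {p : Fin 2 → V → ℝ} (c : Fin 2) (hp : ∀ x, p x ∈ stdSimplex ℝ V)
    (h : ∀ a b, p c a ≠ 0 → p c.rev b ≠ 0 → G.Adj a b) : p ∈ homComplex (K 2) G := by
  refine mem_homComplex_iff.2 ⟨hp, fun x y hxy a b ha hb => ?_⟩
  have hxy : x ≠ y := hxy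
  by_cases hx : x = c
  · obtain rfl : y = c.rev := by subst hx; fin_cases x <;> fin_cases y <;> simp_all
    subst hx
    exact h a b ha hb
  · obtain rfl : x = c.rev := by fin_cases x <;> fin_cases c <;> simp_all
    obtain rfl : y = c := by fin_cases c <;> fin_cases y <;> simp_all
    exact (h b a hb ha).symm

theorem adj_of_mem_homComplex_K2 {p : Fin 2 → V → ℝ} (hp : p ∈ homComplex (K 2) G) (c : Fin 2)
    {a b : V} (ha : p c a ≠ 0) (hb : p c.rev b ≠ 0) : G.Adj a b :=
  (mem_homComplex_iff.1 hp).2 c c.rev (by fin_cases c <;> simp [Fin.rev]) a b ha hb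

theorem edgeVertex_mem {c : Fin 2} {u v : V} (h : G.Adj u v) :
    edgeVertex c u v ∈ homComplex (K 2) G := by
  refine mem_homComplex_K2 c (edgeVertex_mem_stdSimplex c u v) fun a b ha hb => ?_
  have hc : c.rev ≠ c := by fin_cases c <;> simp [Fin.rev]
  simp only [edgeVertex, if_true, if_neg hc, Pi.single_apply, ne_eq, ite_eq_right_iff, one_ne_zero,
    imp_false, not_not] at ha hb
  rwa [ha, hb]

/-- The star from `u` to `{v, v'}` is a cell, and both vertices are joined to its midpoint. -/
theorem joinedIn_edgeVertex_of_adj {c : Fin 2} {u v v' : V} (h : G.Adj u v) (h' : G.Adj u v') :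
    JoinedIn (homComplex (K 2) G) (edgeVertex c u v) (edgeVertex c u v') := by
  have hc : c.rev ≠ c := by fin_cases c <;> simp [Fin.rev]
  let q : Fin 2 → V → ℝ := (2⁻¹ : ℝ) • edgeVertex c u v + (2⁻¹ : ℝ) • edgeVertex c u v'
  have hq : q ∈ homComplex (K 2) G := by
    refine mem_homComplex_K2 c (fun x => convex_stdSimplex ℝ V (edgeVertex_mem_stdSimplex c u v x)
      (edgeVertex_mem_stdSimplex c u v' x) (by norm_num) (by norm_num) (by norm_num))
      fun a b ha hb => ?_
    have ha' : a = u := by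
      by_contra hne
      simp [q, edgeVertex, hne] at ha
    have hb' : b = v ∨ b = v' := by
      by_contra hne
      rw [not_or] at hne
      simp [q, edgeVertex, hne.1, hne.2, hc] at hb
    obtain rfl := ha'
    obtain rfl | rfl := hb'
    exacts [h, h']
  have hnn (w x a) : 0 ≤ edgeVertex c u w x a := (edgeVertex_mem_stdSimplex c u w x).1 a
  refine (joinedIn_of_support hq (edgeVertex_mem_stdSimplex c u v) fun x a ha => ?_).trans
    (joinedIn_of_support hq (edgeVertex_mem_stdSimplex c u v') fun x a ha => ?_).symm
  · have h₁ := (hnn v x a).lt_of_ne' ha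
    have h₂ := hnn v' x a
    have : 0 < q x a := by
      simp only [q, Pi.add_apply, Pi.smul_apply, smul_eq_mul]
      positivity
    exact this.ne'
  · have h₁ := (hnn v' x a).lt_of_ne' ha
    have h₂ := hnn v x a
    have : 0 < q x a := by
      simp only [q, Pi.add_apply, Pi.smul_apply, smul_eq_mul]
      positivity
    exact this.ne'

/-- Moving the far end of the oriented edge to the next vertex of the walk makes that vertex the new
near end, in the opposite coordinate. The final coordinate thus depends on the parity of the walk.
-/
theorem joinedIn_edgeVertex_of_walk {u u' : V} (p : G.Walk u u') (c : Fin 2) {v v' : V}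
    (h : G.Adj u v) (h' : G.Adj u' v') :
    JoinedIn (homComplex (K 2) G) (edgeVertex c u v) (edgeVertex (Fin.rev^[p.length] c) u' v') := by
  induction p generalizing c v with
  | nil => exact joinedIn_edgeVertex_of_adj h h'
  | cons huw p ih =>
    refine (joinedIn_edgeVertex_of_adj h huw).trans ?_
    rw [← edgeVertex_rev]
    exact ih c.rev huw.symm h'

/-- If a walk through a base point of an odd closed walk is odd, inserting that closed walk corrects
its parity. -/
theorem exists_even_walk (hG : G.Connected) (h2 : ¬ G.Colorable 2) (u v : V) :
    ∃ p : G.Walk u v, Even p.length := by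
  rw [SimpleGraph.two_colorable_iff_forall_loop_even] at h2
  push Not at h2
  obtain ⟨z, w, hw⟩ := h2
  obtain ⟨p⟩ := hG.preconnected u z
  obtain ⟨q⟩ := hG.preconnected z v
  by_cases h : Even (p.length + q.length)
  · exact ⟨p.append q, by simpa using h⟩
  · refine ⟨(p.append w).append q, ?_⟩
    simp only [SimpleGraph.Walk.length_append]
    simp only [Nat.not_even_iff_odd] at *
    grind

theorem exists_adj_of_not_colorable (hG : G.Connected) (h2 : ¬ G.Colorable 2) (u : V) :
    ∃ v, G.Adj u v := by
  by_contra! h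
  have hu (v : V) : v = u := by
    obtain ⟨p⟩ := hG.preconnected u v
    cases p with
    | nil => rfl
    | cons h' _ => exact (h _ h').elim
  exact h2 ⟨SimpleGraph.Coloring.mk (fun _ => 0) fun {a b} hab => by
    rw [hu a] at hab
    exact (h _ hab).elim⟩

/-- Even walks preserve the coordinate, so one oriented edge reaches all others, and every point is
joined to a vertex of its support cell. -/
theorem isPathConnected_homComplex_K2 (hG : G.Connected) (h2 : ¬ G.Colorable 2) :
    IsPathConnected (homComplex (K 2) G) := by
  obtain ⟨u⟩ := hG.nonempty
  obtain ⟨v, huv⟩ := exists_adj_of_not_colorable hG h2 u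
  refine ⟨edgeVertex 0 u v, edgeVertex_mem huv, fun {p} hp => ?_⟩
  have hex (x : Fin 2) : ∃ a, p x a ≠ 0 := by
    by_contra! h0
    have := ((mem_homComplex_iff.1 hp).1 x).2
    simp [h0] at this
  obtain ⟨a, ha⟩ := hex 0
  obtain ⟨b, hb⟩ := hex 1
  have hab : G.Adj a b := adj_of_mem_homComplex_K2 hp 0 ha hb
  obtain ⟨q, hq⟩ := exists_even_walk hG h2 u a
  have h1 := joinedIn_edgeVertex_of_walk q 0 huv hab
  rw [Fin.rev_involutive.iterate_even hq] at h1
  refine h1.trans (joinedIn_of_support hp (edgeVertex_mem_stdSimplex 0 a b) fun x c hc => ?_)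
  fin_cases x
  · by_cases hca : c = a
    · rwa [hca]
    · simp [edgeVertex, hca] at hc
  · by_cases hcb : c = b
    · rwa [hcb]
    · simp [edgeVertex, hcb] at hc

end EdgeComplex

/-! ### Pushing points of simplices forward and back -/

section Push

variable {V' V : Type*} [Fintype V'] [Fintype V]

/-- Extension by zero along a map of vertices. -/
noncomputable def push (φ : V' → V) (q : V' → ℝ) : V → ℝ := Function.extend φ q (0 : V → ℝ)

theorem push_apply {φ : V' → V} (hφ : φ.Injective) (q : V' → ℝ) (a : V') :
    push φ q (φ a) = q a := hφ.extend_apply q (0 : V → ℝ) a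

theorem push_apply_of_notMem {φ : V' → V} (q : V' → ℝ) {x : V} (hx : x ∉ Set.range φ) :
    push φ q x = 0 := Function.extend_apply' q (0 : V → ℝ) x hx

theorem exists_of_push_ne_zero {φ : V' → V} (hφ : φ.Injective) {q : V' → ℝ} {x : V}
    (h : push φ q x ≠ 0) : ∃ a, φ a = x ∧ q a ≠ 0 := by
  by_cases hx : x ∈ Set.range φ
  · obtain ⟨a, rfl⟩ := hx
    exact ⟨a, rfl, by rwa [push_apply hφ] at h⟩
  · exact (h (push_apply_of_notMem q hx)).elim

theorem push_injective {φ : V' → V} (hφ : φ.Injective) : (push φ).Injective := by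
  intro q q' h
  ext a
  rw [← push_apply hφ q, h, push_apply hφ]

theorem push_mem_stdSimplex {φ : V' → V} (hφ : φ.Injective) {q : V' → ℝ}
    (hq : q ∈ stdSimplex ℝ V') : push φ q ∈ stdSimplex ℝ V := by
  refine ⟨fun x => ?_, ?_⟩
  · by_cases hx : x ∈ Set.range φ
    · obtain ⟨a, rfl⟩ := hx
      rw [push_apply hφ]
      exact hq.1 a
    · rw [push_apply_of_notMem q hx]
  · rw [← hq.2]
    exact (Fintype.sum_of_injective φ hφ q (push φ q) (fun x hx => push_apply_of_notMem q hx)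
      fun a => (push_apply hφ q a).symm).symm

theorem push_single [DecidableEq V'] [DecidableEq V] {φ : V' → V} (hφ : φ.Injective) (a : V') :
    push φ (Pi.single a 1) = Pi.single (φ a) 1 := by
  ext x
  by_cases hx : x ∈ Set.range φ
  · obtain ⟨a', rfl⟩ := hx
    rw [push_apply hφ]
    simp [Pi.single_apply, hφ.eq_iff]
  · rw [push_apply_of_notMem _ hx, Pi.single_apply, if_neg]
    rintro rfl
    exact hx ⟨a, rfl⟩

theorem continuous_push (φ : V' → V) (hφ : φ.Injective) : Continuous (push φ) := by
  refine continuous_pi fun x => ?_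
  by_cases hx : x ∈ Set.range φ
  · obtain ⟨a, rfl⟩ := hx
    simp only [push_apply hφ]
    fun_prop
  · simp only [push_apply_of_notMem _ hx]
    fun_prop

/-- The part of a point supported in `V'`, scaled by `r`, with the missing mass put at `a`. -/
def retract (φ : V' → V) (a : V' → ℝ) (r : ℝ) (p : V → ℝ) : V' → ℝ :=
  r • (p ∘ φ) + (1 - r * ∑ x, p (φ x)) • a

theorem continuous_retract (φ : V' → V) (a : V' → ℝ) :
    Continuous fun q : ℝ × (V → ℝ) => retract φ a q.1 q.2 := by
  unfold retract
  refine continuous_pi fun x => ?_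
  simp only [Pi.add_apply, Pi.smul_apply, Function.comp_apply, smul_eq_mul]
  fun_prop

theorem sum_comp_le_one {φ : V' → V} (hφ : φ.Injective) {p : V → ℝ} (hp : p ∈ stdSimplex ℝ V) :
    ∑ x, p (φ x) ≤ 1 := by
  rw [← hp.2]
  refine (Finset.sum_map Finset.univ ⟨φ, hφ⟩ p).symm.le.trans ?_
  exact Finset.sum_le_sum_of_subset_of_nonneg (Finset.subset_univ _) fun x _ _ => hp.1 x

theorem retract_mem_stdSimplex {φ : V' → V} (hφ : φ.Injective) {a : V' → ℝ}
    (ha : a ∈ stdSimplex ℝ V') {r : ℝ} (hr : r ∈ I) {p : V → ℝ} (hp : p ∈ stdSimplex ℝ V) :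
    retract φ a r p ∈ stdSimplex ℝ V' := by
  have h₁ := sum_comp_le_one hφ hp
  have h₀ : 0 ≤ ∑ x, p (φ x) := Finset.sum_nonneg fun x _ => hp.1 _
  refine ⟨fun x => ?_, ?_⟩
  · have : r * ∑ x, p (φ x) ≤ 1 := mul_le_one₀ hr.2 h₀ h₁
    have := mul_nonneg (sub_nonneg.2 this) (ha.1 x)
    have := mul_nonneg hr.1 (hp.1 (φ x))
    simp only [retract, Pi.add_apply, Pi.smul_apply, Function.comp_apply, smul_eq_mul]
    linarith
  · simp only [retract, Pi.add_apply, Pi.smul_apply, Function.comp_apply, smul_eq_mul,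
      Finset.sum_add_distrib, ← Finset.mul_sum, ha.2]
    ring

theorem retract_ne_zero {φ : V' → V} {a : V' → ℝ} {r : ℝ} {p : V → ℝ} {x : V'}
    (h : retract φ a r p x ≠ 0) : p (φ x) ≠ 0 ∨ a x ≠ 0 := by
  by_contra! h'
  simp [retract, h'.1, h'.2] at h

theorem retract_zero (φ : V' → V) (a : V' → ℝ) (p : V → ℝ) : retract φ a 0 p = a := by
  simp [retract]

theorem retract_one_push {φ : V' → V} (hφ : φ.Injective) (a : V' → ℝ) {q : V' → ℝ}
    (hq : q ∈ stdSimplex ℝ V') : retract φ a 1 (push φ q) = q := by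
  ext x
  simp [retract, push_apply hφ, hq.2]

/-- If the part over `V'` is already a multiple of `a`, restoring the missing mass at `a` returns
`a`, whatever the scaling. -/
theorem retract_of_comp_eq_smul {φ : V' → V} {a : V' → ℝ} (ha : a ∈ stdSimplex ℝ V') {r s : ℝ}
    {p : V → ℝ} (h : ∀ x, p (φ x) = s * a x) : retract φ a r p = a := by
  ext x
  simp only [retract, Pi.add_apply, Pi.smul_apply, Function.comp_apply, smul_eq_mul, h,
    ← Finset.mul_sum, ha.2]
  ring

theorem push_mem_homComplex {W : Type*} {T : SimpleGraph W} {G' : SimpleGraph V'}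
    {G : SimpleGraph V} {φ : V' → V} (hφ : φ.Injective)
    (hadj : ∀ {a a'}, G.Adj (φ a) (φ a') ↔ G'.Adj a a') {p : W → V' → ℝ}
    (hp : p ∈ homComplex T G') : (fun x => push φ (p x)) ∈ homComplex T G := by
  rw [mem_homComplex_iff] at hp ⊢
  refine ⟨fun x => push_mem_stdSimplex hφ (hp.1 x), fun x y hxy a b ha hb => ?_⟩
  obtain ⟨a, rfl, ha'⟩ := exists_of_push_ne_zero hφ ha
  obtain ⟨b, rfl, hb'⟩ := exists_of_push_ne_zero hφ hb
  exact hadj.2 (hp.2 x y hxy a b ha' hb')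

theorem exists_push_eq {W : Type*} {T : SimpleGraph W} {G' : SimpleGraph V'}
    {G : SimpleGraph V} {φ : V' → V} (hφ : φ.Injective)
    (hadj : ∀ {a a'}, G.Adj (φ a) (φ a') ↔ G'.Adj a a') {p : W → V → ℝ}
    (hp : p ∈ homComplex T G) (hs : ∀ x z, p x z ≠ 0 → z ∈ Set.range φ) :
    ∃ q ∈ homComplex T G', (fun x => push φ (q x)) = p := by
  have hz (x z) (hz : z ∉ Set.range φ) : p x z = 0 := by
    by_contra hne
    exact hz (hs x z hne)
  have hp' := mem_homComplex_iff.1 hp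
  refine ⟨fun x => p x ∘ φ, mem_homComplex_iff.2 ⟨fun x => ⟨fun a => (hp'.1 x).1 _, ?_⟩,
    fun x y hxy a b ha hb => hadj.1 (hp'.2 x y hxy _ _ ha hb)⟩, ?_⟩
  · rw [← (hp'.1 x).2]
    exact Fintype.sum_of_injective φ hφ _ _ (fun z => hz x z) fun a => rfl
  · ext x z
    by_cases hzr : z ∈ Set.range φ
    · obtain ⟨a, rfl⟩ := hzr
      exact push_apply hφ _ _
    · rw [push_apply_of_notMem _ hzr, hz x z hzr]

/-- If all cells of `Hom(T, G)` lie in the induced subgraph `G'`, then the Hom complexes agree. -/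
theorem nonempty_homeomorph_of_support {W : Type*} [Finite W] {T : SimpleGraph W}
    {G' : SimpleGraph V'} {G : SimpleGraph V} {φ : V' → V} (hφ : φ.Injective)
    (hadj : ∀ {a a'}, G.Adj (φ a) (φ a') ↔ G'.Adj a a')
    (hs : ∀ p ∈ homComplex T G, ∀ x z, p x z ≠ 0 → z ∈ Set.range φ) :
    Nonempty (homComplex T G' ≃ₜ homComplex T G) := by
  let f : homComplex T G' → homComplex T G := fun p => ⟨_, push_mem_homComplex hφ hadj p.2⟩
  have hf : Continuous f := Continuous.subtype_mk (continuous_pi fun x =>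
    (continuous_push φ hφ).comp ((continuous_apply x).comp continuous_subtype_val)) _
  have hbij : f.Bijective := by
    refine ⟨fun p q hpq => ?_, fun p => ?_⟩
    · ext x : 2
      exact push_injective hφ (congrFun (congrArg Subtype.val hpq) x)
    · obtain ⟨q, hq, heq⟩ := exists_push_eq hφ hadj p.2 (hs p p.2)
      exact ⟨⟨q, hq⟩, Subtype.ext heq⟩
  exact ⟨Continuous.homeoOfEquivCompactToT2 (f := Equiv.ofBijective f hbij) hf⟩

end Push

/-! ### Gluings of graphs -/

/-- The graph `G` is obtained by gluing `G₁` and `G₂` along vertices that are pairwise at distance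
at least `3`. -/
structure IsGluing {V₁ V₂ V ι : Type*} (G₁ : SimpleGraph V₁) (G₂ : SimpleGraph V₂)
    (G : SimpleGraph V) (φ₁ : V₁ → V) (φ₂ : V₂ → V) (v : ι → V₁) (w : ι → V₂) : Prop where
  injective₁ : φ₁.Injective
  injective₂ : φ₂.Injective
  adj₁ : ∀ {a a'}, G.Adj (φ₁ a) (φ₁ a') ↔ G₁.Adj a a'
  adj₂ : ∀ {b b'}, G.Adj (φ₂ b) (φ₂ b') ↔ G₂.Adj b b'
  exists_of_adj : ∀ {x y}, G.Adj x y →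
    (∃ a a', φ₁ a = x ∧ φ₁ a' = y) ∨ ∃ b b', φ₂ b = x ∧ φ₂ b' = y
  glue : ∀ i, φ₁ (v i) = φ₂ (w i)
  exists_of_eq : ∀ {a b}, φ₁ a = φ₂ b → ∃ i, v i = a ∧ w i = b
  not_adj : ∀ i j, ¬ G.Adj (φ₁ (v i)) (φ₁ (v j))
  eq_of_adj : ∀ i j x, G.Adj (φ₁ (v i)) x → G.Adj (φ₁ (v j)) x → i = j

theorem exists_ne_zero_of_mem_stdSimplex {V : Type*} [Fintype V] {p : V → ℝ}
    (hp : p ∈ stdSimplex ℝ V) : ∃ z, p z ≠ 0 := by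
  by_contra! h0
  have := hp.2
  simp [h0] at this

namespace IsGluing

variable {V₁ V₂ V ι : Type*} {G₁ : SimpleGraph V₁} {G₂ : SimpleGraph V₂}
    {G : SimpleGraph V} {φ₁ : V₁ → V} {φ₂ : V₂ → V} {v : ι → V₁} {w : ι → V₂}
    (h : IsGluing G₁ G₂ G φ₁ φ₂ v w)
include h

theorem symm : IsGluing G₂ G₁ G φ₂ φ₁ w v where
  injective₁ := h.injective₂
  injective₂ := h.injective₁
  adj₁ := h.adj₂
  adj₂ := h.adj₁
  exists_of_adj hxy := (h.exists_of_adj hxy).symm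
  glue i := (h.glue i).symm
  exists_of_eq hab := by
    obtain ⟨i, h₁, h₂⟩ := h.exists_of_eq hab.symm
    exact ⟨i, h₂, h₁⟩
  not_adj i j := by
    rw [← h.glue, ← h.glue]
    exact h.not_adj i j
  eq_of_adj i j x := by
    rw [← h.glue, ← h.glue]
    exact h.eq_of_adj i j x

variable [Fintype V₁] [Fintype V₂] [Fintype V] [DecidableEq V₁] [DecidableEq V₂] [DecidableEq V]

/-- The inclusion of Hom complexes. -/
noncomputable def incl₁ : C(homComplex (K 2) G₁, Fin 2 → V → ℝ) where
  toFun p x := push φ₁ (p.1 x)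
  continuous_toFun := continuous_pi fun x => (continuous_push φ₁ h.injective₁).comp
    ((continuous_apply x).comp continuous_subtype_val)

theorem incl₁_injective : Function.Injective h.incl₁ := by
  intro p q hpq
  ext x : 2
  exact push_injective h.injective₁ (congrFun hpq x)

theorem incl₁_mem (p : homComplex (K 2) G₁) : h.incl₁ p ∈ homComplex (K 2) G :=
  push_mem_homComplex h.injective₁ h.adj₁ p.2

theorem exists_incl₁_eq {p : Fin 2 → V → ℝ} (hp : p ∈ homComplex (K 2) G)
    (h₁ : ∀ x z, p x z ≠ 0 → z ∈ Set.range φ₁) : ∃ q, h.incl₁ q = p := by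
  obtain ⟨q, hq, heq⟩ := exists_push_eq h.injective₁ h.adj₁ hp h₁
  exact ⟨⟨q, hq⟩, heq⟩

/-- The cells mapping the vertex `c` of `K₂` to the `i`-th glued vertex. -/
def bridge (_ : IsGluing G₁ G₂ G φ₁ φ₂ v w) (k : ι × Fin 2) : Set (Fin 2 → V → ℝ) :=
  {p | p ∈ homComplex (K 2) G ∧ p k.2 = Pi.single (φ₁ (v k.1)) 1}

theorem symm_bridge (k : ι × Fin 2) : h.symm.bridge k = h.bridge k := by
  simp only [bridge, h.glue]

theorem adj_of_mem_bridge {k : ι × Fin 2} {p : Fin 2 → V → ℝ} (hp : p ∈ h.bridge k) {z : V}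
    (hz : p k.2.rev z ≠ 0) : G.Adj (φ₁ (v k.1)) z :=
  adj_of_mem_homComplex_K2 hp.1 k.2 (by rw [hp.2]; simp) hz

/-- A bridge is a point times the full simplex on the neighbours of the glued vertex. -/
theorem convex_bridge (k : ι × Fin 2) : Convex ℝ (h.bridge k) := by
  intro p hp q hq r s hr hs hrs
  have heq : (r • p + s • q) k.2 = Pi.single (φ₁ (v k.1)) 1 := by
    simp only [Pi.add_apply, Pi.smul_apply, hp.2, hq.2]
    rw [← add_smul, hrs, one_smul]
  refine ⟨mem_homComplex_K2 k.2 (fun x => convex_stdSimplex ℝ V ((mem_homComplex_iff.1 hp.1).1 x)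
    ((mem_homComplex_iff.1 hq.1).1 x) hr hs hrs) fun a b ha hb => ?_, heq⟩
  rw [heq] at ha
  obtain rfl : a = φ₁ (v k.1) := by
    by_contra hne
    simp [hne] at ha
  by_cases hpb : p k.2.rev b = 0
  · by_cases hqb : q k.2.rev b = 0
    · simp [hpb, hqb] at hb
    · exact h.adj_of_mem_bridge hq hqb
  · exact h.adj_of_mem_bridge hp hpb

theorem isClosed_bridge (k : ι × Fin 2) : IsClosed (h.bridge k) :=
  isCompact_homComplex.isClosed.inter (isClosed_eq (continuous_apply _) continuous_const)

theorem disjoint_bridge {k l : ι × Fin 2} (hkl : k ≠ l) {p : Fin 2 → V → ℝ} (hk : p ∈ h.bridge k)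
    (hl : p ∈ h.bridge l) : False := by
  by_cases hc : k.2 = l.2
  · have := hk.2.symm.trans (hc ▸ hl.2)
    have := congrFun this (φ₁ (v k.1))
    rw [Pi.single_eq_same, Pi.single_apply] at this
    split_ifs at this with heq
    · refine hkl (Prod.ext ?_ hc)
      -- Injectivity of `v` is not part of `IsGluing`; the indices agree because the glued vertices
      -- share the neighbour `z`.
      obtain ⟨z, hz⟩ :=
        exists_ne_zero_of_mem_stdSimplex ((mem_homComplex_iff.1 hk.1).1 k.2.rev)
      exact h.eq_of_adj _ _ z (h.adj_of_mem_bridge hk hz) (heq ▸ h.adj_of_mem_bridge hk hz)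
    · norm_num at this
  · have hrev : k.2.rev = l.2 := by
      obtain ⟨i, c⟩ := k
      obtain ⟨j, d⟩ := l
      fin_cases c <;> fin_cases d <;> simp_all
    exact h.not_adj k.1 l.1 (h.adj_of_mem_bridge hk (by rw [hrev, hl.2]; simp))

/-- Every point lies in one of the two parts or in a bridge. -/
theorem exists_of_mem {p : Fin 2 → V → ℝ} (hp : p ∈ homComplex (K 2) G) :
    (∃ q, h.incl₁ q = p) ∨ (∃ q, h.symm.incl₁ q = p) ∨ ∃ k, p ∈ h.bridge k := by
  have hp' := (mem_homComplex_iff.1 hp).1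
  by_cases h₁ : ∀ x z, p x z ≠ 0 → z ∈ Set.range φ₁
  · exact Or.inl (h.exists_incl₁_eq hp h₁)
  by_cases h₂ : ∀ x z, p x z ≠ 0 → z ∈ Set.range φ₂
  · exact Or.inr (Or.inl (h.symm.exists_incl₁_eq hp h₂))
  right; right
  push Not at h₁ h₂
  obtain ⟨c, z, hz, hz'⟩ := h₁
  obtain ⟨d, y, hy, hy'⟩ := h₂
  -- A vertex outside `V₁` and one outside `V₂` are never adjacent, so they occur in the same
  -- coordinate.
  have hcd : d = c := by
    by_contra hne
    have hd : d = c.rev := by fin_cases c <;> fin_cases d <;> simp_all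
    subst hd
    obtain ⟨a, a', ha, -⟩ | ⟨b, b', -, hb⟩ :=
      h.exists_of_adj (adj_of_mem_homComplex_K2 hp c hz hy)
    exacts [hz' ⟨a, ha⟩, hy' ⟨b', hb⟩]
  subst hcd
  -- A vertex in the other coordinate is adjacent to both `z` and `y`, hence lies in both parts and
  -- is glued.
  have key (x : V) (hx : p d.rev x ≠ 0) : ∃ i, φ₁ (v i) = x := by
    obtain ⟨a, a', ha, -⟩ | ⟨b, b', -, hb⟩ := h.exists_of_adj (adj_of_mem_homComplex_K2 hp d hz hx)
    · exact (hz' ⟨a, ha⟩).elim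
    obtain ⟨a, a', -, ha⟩ | ⟨b, b', hb', -⟩ := h.exists_of_adj (adj_of_mem_homComplex_K2 hp d hy hx)
    · obtain ⟨i, hi, -⟩ := h.exists_of_eq (ha.trans hb.symm)
      exact ⟨i, hi ▸ ha⟩
    · exact (hy' ⟨b, hb'⟩).elim
  obtain ⟨x, hx⟩ := exists_ne_zero_of_mem_stdSimplex (hp' d.rev)
  obtain ⟨i, rfl⟩ := key x hx
  refine ⟨(i, d.rev), hp, ?_⟩
  -- All these glued vertices have the neighbour `z`, so there is only one: the cell is a star.
  have hzero (x) (hxi : x ≠ φ₁ (v i)) : p d.rev x = 0 := by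
    by_contra hne
    obtain ⟨j, rfl⟩ := key x hne
    obtain rfl := h.eq_of_adj i j z (adj_of_mem_homComplex_K2 hp d hz hx).symm
      (adj_of_mem_homComplex_K2 hp d hz hne).symm
    exact hxi rfl
  ext x
  by_cases hxi : x = φ₁ (v i)
  · have := (hp' d.rev).2
    rw [Finset.sum_eq_single (φ₁ (v i)) (fun y _ hy => hzero y hy) (by simp)] at this
    rw [hxi, this, Pi.single_eq_same]
  · rw [hzero x hxi, Pi.single_eq_of_ne hxi]

/-- A common point would be supported on glued vertices in both coordinates, giving an edge between
glued vertices. -/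
theorem incl₁_ne (p : homComplex (K 2) G₁) (q : homComplex (K 2) G₂) :
    h.incl₁ p ≠ h.symm.incl₁ q := by
  intro heq
  have hex (x : Fin 2) : ∃ i, h.incl₁ p x (φ₁ (v i)) ≠ 0 := by
    obtain ⟨z, hz⟩ :=
      exists_ne_zero_of_mem_stdSimplex ((mem_homComplex_iff.1 (h.incl₁_mem p)).1 x)
    obtain ⟨a, rfl, -⟩ := exists_of_push_ne_zero h.injective₁ hz
    rw [heq] at hz
    obtain ⟨b, hb, -⟩ := exists_of_push_ne_zero h.injective₂ hz
    obtain ⟨i, rfl, -⟩ := h.exists_of_eq hb.symm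
    exact ⟨i, heq ▸ hz⟩
  obtain ⟨i, hi⟩ := hex 0
  obtain ⟨j, hj⟩ := hex 1
  exact h.not_adj i j (adj_of_mem_homComplex_K2 (h.incl₁_mem p) 0 hi hj)

end IsGluing

/-! ### Retracting a bridge to its two ends -/

namespace IsGluing

variable {V₁ V₂ V ι : Type*} {G₁ : SimpleGraph V₁} {G₂ : SimpleGraph V₂}
    {G : SimpleGraph V} {φ₁ : V₁ → V} {φ₂ : V₂ → V} {v : ι → V₁} {w : ι → V₂}
    (h : IsGluing G₁ G₂ G φ₁ φ₂ v w)
    [Fintype V₁] [Fintype V₂] [Fintype V] [DecidableEq V₁] [DecidableEq V₂] [DecidableEq V]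

theorem rev_ne (c : Fin 2) : c.rev ≠ c := by fin_cases c <;> simp [Fin.rev]

theorem eq_or_eq_rev (c x : Fin 2) : x = c ∨ x = c.rev := by
  fin_cases c <;> fin_cases x <;> simp

theorem edgeVertex_self (c : Fin 2) (a b : V) : edgeVertex c a b c = Pi.single a 1 := if_pos rfl

theorem edgeVertex_rev_self (c : Fin 2) (a b : V) :
    edgeVertex c a b c.rev = Pi.single b 1 := if_neg (rev_ne c)

include h in
theorem ne_of_adj {i : ι} {b : V₂} (hb : G₂.Adj (w i) b) (a : V₁) : φ₁ a ≠ φ₂ b := by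
  intro heq
  obtain ⟨j, rfl, rfl⟩ := h.exists_of_eq heq
  have := h.adj₂.2 hb
  rw [← h.glue, ← h.glue] at this
  exact h.not_adj _ _ this

/-- The centre coordinate stays at `v k.1`, and mass is only added at `n₁ k.1`, another neighbour of
the centre. -/
theorem retract_mem {n₁ : ι → V₁} (hn₁ : ∀ i, G₁.Adj (v i) (n₁ i)) (k : ι × Fin 2)
    {r : ℝ} (hr : r ∈ I) {p : Fin 2 → V → ℝ} (hp : p ∈ h.bridge k) :
    (fun x => retract φ₁ (edgeVertex k.2 (v k.1) (n₁ k.1) x) r (p x)) ∈ homComplex (K 2) G₁ := by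
  refine mem_homComplex_K2 k.2 (fun x => retract_mem_stdSimplex h.injective₁
    (edgeVertex_mem_stdSimplex _ _ _ _) hr ((mem_homComplex_iff.1 hp.1).1 x)) fun a b ha hb => ?_
  obtain rfl : a = v k.1 := by
    by_contra hne
    obtain ha | ha := retract_ne_zero ha
    · rw [hp.2, Pi.single_eq_of_ne (h.injective₁.ne hne)] at ha
      exact ha rfl
    · rw [edgeVertex_self, Pi.single_eq_of_ne hne] at ha
      exact ha rfl
  obtain hb | hb := retract_ne_zero hb
  · exact h.adj₁.1 (h.adj_of_mem_bridge hp hb)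
  · rw [edgeVertex_rev_self] at hb
    obtain rfl : b = n₁ k.1 := by
      by_contra hne
      exact hb (Pi.single_eq_of_ne hne _)
    exact hn₁ _

/-- The endpoint of the bridge in the first part. -/
def base₁ (_ : IsGluing G₁ G₂ G φ₁ φ₂ v w) {n₁ : ι → V₁} (hn₁ : ∀ i, G₁.Adj (v i) (n₁ i))
    (k : ι × Fin 2) : homComplex (K 2) G₁ :=
  ⟨edgeVertex k.2 (v k.1) (n₁ k.1), edgeVertex_mem (hn₁ _)⟩

/-- The map from a bridge to the first part, depending on a function `r`. -/
noncomputable def toPart₁ {n₁ : ι → V₁} (hn₁ : ∀ i, G₁.Adj (v i) (n₁ i)) (k : ι × Fin 2)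
    (r : C(Fin 2 → V → ℝ, I)) : C(h.bridge k, homComplex (K 2) G₁) where
  toFun p := ⟨_, h.retract_mem hn₁ k (r p).2 p.2⟩
  continuous_toFun := by
    refine Continuous.subtype_mk (continuous_pi fun x => ?_) _
    exact (continuous_retract φ₁ _).comp (Continuous.prodMk
      (continuous_subtype_val.comp (r.continuous.comp continuous_subtype_val))
      ((continuous_apply x).comp continuous_subtype_val))

variable {n₁ : ι → V₁} (hn₁ : ∀ i, G₁.Adj (v i) (n₁ i)) {n₂ : ι → V₂}
  (hn₂ : ∀ i, G₂.Adj (w i) (n₂ i)) (k : ι × Fin 2) (r : C(Fin 2 → V → ℝ, I))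

theorem incl₁_apply_self {q : homComplex (K 2) G₁} {a : V₁} {c : Fin 2}
    (hq : q.1 c = Pi.single a 1) : h.incl₁ q c = Pi.single (φ₁ a) 1 := by
  change push φ₁ (q.1 c) = _
  rw [hq, push_single h.injective₁]

theorem incl₁_base₁_mem : h.incl₁ (h.base₁ hn₁ k) ∈ h.bridge k :=
  ⟨h.incl₁_mem _, h.incl₁_apply_self (edgeVertex_self _ _ _)⟩

theorem comp_eq_of_mem_bridge {p : Fin 2 → V → ℝ} (hp : p ∈ h.bridge k) (a : V₁) :
    p k.2 (φ₁ a) = 1 * edgeVertex k.2 (v k.1) (n₁ k.1) k.2 a := by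
  rw [hp.2, edgeVertex_self, one_mul, Pi.single_apply, Pi.single_apply]
  simp only [h.injective₁.eq_iff]

theorem incl₁_toPart₁_mem (p : h.bridge k) : h.incl₁ (h.toPart₁ hn₁ k r p) ∈ h.bridge k := by
  refine ⟨h.incl₁_mem _, h.incl₁_apply_self ?_⟩
  change retract φ₁ (edgeVertex k.2 (v k.1) (n₁ k.1) k.2) (r p) (p.1 k.2) = _
  rw [retract_of_comp_eq_smul (edgeVertex_mem_stdSimplex _ _ _ _)
    (h.comp_eq_of_mem_bridge k p.2), edgeVertex_self]

theorem toPart₁_incl₁ (q : homComplex (K 2) G₁) (hq : h.incl₁ q ∈ h.bridge k)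
    (hr : r (h.incl₁ q) = 1) : h.toPart₁ hn₁ k r ⟨_, hq⟩ = q := by
  ext x : 2
  change retract φ₁ _ (r (h.incl₁ q)) (push φ₁ (q.1 x)) = _
  rw [hr]
  exact retract_one_push h.injective₁ _ ((mem_homComplex_iff.1 q.2).1 x)

theorem toPart₁_eq_base₁ (p : h.bridge k) (hr : r p = 0) :
    h.toPart₁ hn₁ k r p = h.base₁ hn₁ k := by
  ext x : 2
  change retract φ₁ _ (r p) (p.1 x) = _
  rw [hr]
  exact retract_zero _ _ _

/-- Along the segment, each coordinate restricted to `V₁` is a multiple of that of the base vertex,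
because the `G₂`-neighbour of the glued vertex lies outside `V₁`. -/
theorem toPart₁_segment (p : h.bridge k) (s : ℝ) (hp : p.1 =
    (1 - s) • h.incl₁ (h.base₁ hn₁ k) + s • h.symm.incl₁ (h.symm.base₁ hn₂ k)) :
    h.toPart₁ hn₁ k r p = h.base₁ hn₁ k := by
  ext x : 2
  change retract φ₁ _ (r p) (p.1 x) = edgeVertex k.2 (v k.1) (n₁ k.1) x
  obtain rfl | rfl := eq_or_eq_rev k.2 x
  · exact retract_of_comp_eq_smul (edgeVertex_mem_stdSimplex _ _ _ _)
      (h.comp_eq_of_mem_bridge k p.2)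
  · refine retract_of_comp_eq_smul (s := 1 - s) (edgeVertex_mem_stdSimplex _ _ _ _) fun a => ?_
    have h₁ : h.incl₁ (h.base₁ hn₁ k) k.2.rev (φ₁ a) =
      edgeVertex k.2 (v k.1) (n₁ k.1) k.2.rev a := push_apply h.injective₁ _ _
    have h₂ : h.symm.incl₁ (h.symm.base₁ hn₂ k) k.2.rev (φ₁ a) = 0 := by
      rw [h.symm.incl₁_apply_self (edgeVertex_rev_self _ _ _)]
      exact Pi.single_eq_of_ne (h.ne_of_adj (hn₂ _) a) _
    rw [hp, Pi.add_apply, Pi.smul_apply, Pi.smul_apply, Pi.add_apply, Pi.smul_apply,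
      Pi.smul_apply, h₁, h₂]
    simp

/-- The progress from the first part to the second part along a bridge. -/
def progress (_ : IsGluing G₁ G₂ G φ₁ φ₂ v w) (k : ι × Fin 2) : C(Fin 2 → V → ℝ, ℝ) :=
  ⟨fun p => ∑ b, p k.2.rev (φ₂ b), by fun_prop⟩

theorem progress_incl₁ (q : homComplex (K 2) G₁) (hq : h.incl₁ q ∈ h.bridge k) :
    h.progress k (h.incl₁ q) = 0 := by
  refine Finset.sum_eq_zero fun b _ => ?_
  by_contra hne
  have hadj := h.adj_of_mem_bridge hq hne
  obtain ⟨a, ha, -⟩ := exists_of_push_ne_zero h.injective₁ hne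
  obtain ⟨j, -, rfl⟩ := h.exists_of_eq ha
  rw [← h.glue] at hadj
  exact h.not_adj _ _ hadj

theorem progress_incl₂ (q : homComplex (K 2) G₂) : h.progress k (h.symm.incl₁ q) = 1 := by
  rw [← ((mem_homComplex_iff.1 q.2).1 k.2.rev).2]
  exact Finset.sum_congr rfl fun b _ => push_apply h.injective₂ _ _

theorem progress_segment (s : ℝ) : h.progress k ((1 - s) • h.incl₁ (h.base₁ hn₁ k) +
    s • h.symm.incl₁ (h.symm.base₁ hn₂ k)) = s := by
  have hlin (p q : Fin 2 → V → ℝ) (r s : ℝ) :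
      h.progress k (r • p + s • q) = r * h.progress k p + s * h.progress k q := by
    simp [progress, Finset.sum_add_distrib, Finset.mul_sum]
  rw [hlin, h.progress_incl₁ k _ (h.incl₁_base₁_mem hn₁ k), h.progress_incl₂]
  ring

/-- The Hom complex of a gluing as two spaces joined by bridges. -/
noncomputable def bridgeData : BridgeData (Fin 2 → V → ℝ) (homComplex (K 2) G₁)
    (homComplex (K 2) G₂) (ι × Fin 2) (homComplex (K 2) G) where
  j₁ := h.incl₁
  j₂ := h.symm.incl₁
  J := h.bridge
  lam := h.progress
  a := h.base₁ hn₁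
  b := h.symm.base₁ hn₂
  ρ₁ k := h.toPart₁ hn₁ k
    -- The scaling falls from 1 at progress 0 to 0 at progress `1 / 3`; the one for `ρ₂` below rises
    -- from 0 at `2 / 3` to 1 at 1.
    ⟨fun p => Set.projIcc 0 1 zero_le_one (1 - 3 * h.progress k p), by fun_prop⟩
  ρ₂ k := (h.symm.toPart₁ hn₂ k
    ⟨fun p => Set.projIcc 0 1 zero_le_one (3 * h.progress k p - 2), by fun_prop⟩).comp
    ⟨Set.inclusion (h.symm_bridge k).ge, continuous_inclusion _⟩
  j₁_injective := h.incl₁_injective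
  j₂_injective := h.symm.incl₁_injective
  j₁_ne_j₂ := h.incl₁_ne
  j₁_mem := h.incl₁_mem
  j₂_mem := h.symm.incl₁_mem
  J_subset k p hp := hp.1
  J_isClosed := h.isClosed_bridge
  J_convex := h.convex_bridge
  exists_of_mem p hp := h.exists_of_mem hp
  exists_of_mem_J k l hkl p hk hl := (h.disjoint_bridge hkl hk hl).elim
  lam_j₁ := h.progress_incl₁
  lam_j₂ k q _ := h.progress_incl₂ k q
  ρ₁_j₁ k q hq := by
    refine h.toPart₁_incl₁ hn₁ k _ q hq ?_
    rw [ContinuousMap.coe_mk, h.progress_incl₁ k q hq]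
    exact Set.projIcc_of_right_le _ (by norm_num)
  ρ₂_j₂ k q hq := by
    refine h.symm.toPart₁_incl₁ hn₂ k _ q ((h.symm_bridge k).ge hq) ?_
    rw [ContinuousMap.coe_mk, h.progress_incl₂ k q]
    exact Set.projIcc_of_right_le _ (by norm_num)
  j₁_ρ₁_mem k p := h.incl₁_toPart₁_mem hn₁ k _ p
  j₂_ρ₂_mem k p := (h.symm_bridge k).le (h.symm.incl₁_toPart₁_mem hn₂ k _ _)
  ρ₁_eq k p hp := h.toPart₁_eq_base₁ hn₁ k _ p (Set.projIcc_of_le_left zero_le_one (by linarith))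
  ρ₂_eq k p hp := h.symm.toPart₁_eq_base₁ hn₂ k _ _
    (Set.projIcc_of_le_left zero_le_one (by
      change 3 * h.progress k p - 2 ≤ 0
      linarith))
  a_mem := h.incl₁_base₁_mem hn₁
  b_mem k := (h.symm_bridge k).le (h.symm.incl₁_base₁_mem hn₂ k)
  lam_segment k s _ := h.progress_segment hn₁ hn₂ k s
  ρ₁_segment k p s _ hp := h.toPart₁_segment hn₁ hn₂ k _ p s hp
  ρ₂_segment k p s _ hp := by
    refine h.symm.toPart₁_segment hn₂ hn₁ k _ _ (1 - s) ?_
    rw [sub_sub_cancel, add_comm]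
    exact hp

end IsGluing

/-! ### The homotopy type of the gluing -/

/-- Reindexing arcs that share their endpoints. -/
noncomputable def arcAttachReindex {A κ κ' : Type*} [TopologicalSpace A] [TopologicalSpace κ]
    [DiscreteTopology κ] [TopologicalSpace κ'] [DiscreteTopology κ'] (e : κ ≃ κ') (x y : A) :
    ArcAttach (fun _ : κ => x) (fun _ => y) ≃ₕ ArcAttach (fun _ : κ' => x) (fun _ => y) where
  toFun := ArcAttach.desc (ArcAttach.incl _ _) fun k => ArcAttach.arc _ _ (e k)
  invFun := ArcAttach.desc (ArcAttach.incl _ _) fun k => ArcAttach.arc _ _ (e.symm k)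
  left_inv := by
    convert! ContinuousMap.Homotopic.refl _
    refine ArcAttach.map_ext (fun _ => rfl) fun k s => ?_
    change _ = ArcAttach.arc _ _ (e.symm (e k)) s
    rw [e.symm_apply_apply]
    rfl
  right_inv := by
    convert! ContinuousMap.Homotopic.refl _
    refine ArcAttach.map_ext (fun _ => rfl) fun k s => ?_
    change _ = ArcAttach.arc _ _ (e (e.symm k)) s
    rw [e.apply_symm_apply]
    rfl

theorem IsGluing.nonempty_homotopyEquiv {V₁ V₂ V ι : Type*} {G₁ : SimpleGraph V₁}
    {G₂ : SimpleGraph V₂} {G : SimpleGraph V} {φ₁ : V₁ → V} {φ₂ : V₂ → V} {v : ι → V₁} {w : ι → V₂}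
    (h : IsGluing G₁ G₂ G φ₁ φ₂ v w) [Fintype V₁] [Fintype V₂] [Fintype V] [Finite ι]
    (h₁ : G₁.Connected) (h₂ : G₂.Connected) (hc₁ : ¬ G₁.Colorable 2) (hc₂ : ¬ G₂.Colorable 2)
    {n : ℕ} (e : ι × Fin 2 ≃ Fin (n + 1)) (x : homComplex (K 2) G₁) (y : homComplex (K 2) G₂) :
    Nonempty (homComplex (K 2) G ≃ₕ WedgeCircles x y n) := by
  classical
  -- A neighbour of each glued vertex on either side fixes the endpoints of its two arcs.
  choose n₁ hn₁ using fun i => exists_adj_of_not_colorable h₁ hc₁ (v i)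
  choose n₂ hn₂ using fun i => exists_adj_of_not_colorable h₂ hc₂ (w i)
  let _ : TopologicalSpace ι := ⊥
  have : DiscreteTopology ι := ⟨rfl⟩
  have : PathConnectedSpace (homComplex (K 2) G₁) :=
    isPathConnected_iff_pathConnectedSpace.1 (isPathConnected_homComplex_K2 h₁ hc₁)
  have : PathConnectedSpace (homComplex (K 2) G₂) :=
    isPathConnected_iff_pathConnectedSpace.1 (isPathConnected_homComplex_K2 h₂ hc₂)
  let B := h.bridgeData hn₁ hn₂
  obtain ⟨E₁⟩ : Nonempty (B.Arcs ≃ₕ ArcAttach (fun _ : ι × Fin 2 => Sum.inl x)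
      (fun _ => Sum.inr y)) := ArcAttach.nonempty_homotopyEquiv_of_paths
    (fun k => (PathConnectedSpace.somePath (B.a k) x).map continuous_inl)
    (fun k => (PathConnectedSpace.somePath (B.b k) y).map continuous_inr)
  obtain ⟨E₂⟩ := nonempty_arcAttach_homotopyEquiv_wedgeCircles x y (isNondegenerate_homComplex y) n
  exact ⟨((B.homotopyEquivArcs.trans E₁).trans (arcAttachReindex e _ _)).trans E₂⟩

end HomTest

namespace HomTest

open scoped unitInterval Simplicial

/-! ### Nonvanishing of the first homology of the circle -/

instance contractibleSpace_stdSimplex (n : ℕ) : ContractibleSpace (stdSimplex ℝ (Fin (n + 1))) :=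
  (convex_stdSimplex ℝ _).contractibleSpace ⟨_, single_mem_stdSimplex ℝ 0⟩

instance locallyPathConnectedSpace_stdSimplex (n : ℕ) :
    LocallyPathConnectedSpace (stdSimplex ℝ (Fin (n + 1))) :=
  (convex_stdSimplex ℝ _).locallyPathConnectedSpace

/-- A 1-cocycle descends to a functional on homology, so a cycle on which it is nonzero represents a
nonzero class. -/
theorem not_isZero_homology_one {X : SSet.{0}} (φ : X _⦋1⦌ → ZMod 2)
    (hφ : ∀ t : X _⦋2⦌, φ (X.δ 0 t) - φ (X.δ 1 t) + φ (X.δ 2 t) = 0)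
    (x : X _⦋1⦌) (hx : X.δ 0 x = X.δ 1 x) (hφx : φ x ≠ 0) :
    ¬ IsZero ((X.chainComplex (ModuleCat.of (ZMod 2) (ZMod 2))).homology 1) := by
  intro h0
  set R := ModuleCat.of (ZMod 2) (ZMod 2)
  let C := X.chainComplex R
  let Φ : C.X 1 ⟶ R := Sigma.desc fun y : X _⦋1⦌ => φ y • 𝟙 R
  have hΦ (y : X _⦋1⦌) : X.ιChainComplex y ≫ Φ = φ y • 𝟙 R := Sigma.ι_desc _ _
  have hd : C.d 2 1 ≫ Φ = 0 := by
    refine SSet.chainComplex_hom_ext fun t => ?_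
    rw [SSet.ιChainComplex_d_assoc, Preadditive.sum_comp, Fin.sum_univ_three, comp_zero]
    simp only [Preadditive.zsmul_comp, hΦ]
    rw [← zero_smul (ZMod 2) (𝟙 R), ← hφ t, add_smul, sub_smul]
    simp [sub_eq_add_neg]
  have hc : X.ιChainComplex x ≫ C.d 1 0 = (0 : R ⟶ _) := by
    rw [SSet.ιChainComplex_d, Fin.sum_univ_two, hx]
    simp
  let z := C.liftCycles (X.ιChainComplex (R := R) x) 0 (by simp) hc
  let f := C.descOpcycles Φ 2 (by simp) hd
  have h1 : z ≫ C.homologyπ 1 ≫ C.homologyι 1 ≫ f = φ x • 𝟙 R := by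
    rw [HomologicalComplex.homology_π_ι_assoc, HomologicalComplex.p_descOpcycles,
      HomologicalComplex.liftCycles_i_assoc]
    exact hΦ x
  have h2 : z ≫ C.homologyπ 1 ≫ C.homologyι 1 ≫ f = 0 := by
    rw [h0.eq_of_src (C.homologyι 1) 0]
    simp
  rw [h2] at h1
  have h3 := congrArg (fun g : R ⟶ R => g.hom (1 : ZMod 2)) h1
  have h4 : (0 : ZMod 2) = φ x * 1 := h3
  exact hφx (by simpa using h4.symm)

/-! ### The winding cocycle -/

section Winding

theorem exists_lift {n : ℕ} (f : C(stdSimplex ℝ (Fin (n + 1)), Circle)) :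
    ∃ g : C(stdSimplex ℝ (Fin (n + 1)), ℝ), ∀ z, Circle.exp (g z) = f z := by
  obtain ⟨g, ⟨-, hg⟩, -⟩ := Circle.isCoveringMap_exp.existsUnique_continuousMap_lifts f
    (stdSimplex.vertex 0) (Complex.arg (f (stdSimplex.vertex 0))) (Circle.exp_arg _)
  exact ⟨g, congrFun hg⟩

theorem sub_eq_sub_of_lifts {n : ℕ} {f : C(stdSimplex ℝ (Fin (n + 1)), Circle)}
    {g g' : C(stdSimplex ℝ (Fin (n + 1)), ℝ)} (hg : ∀ z, Circle.exp (g z) = f z)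
    (hg' : ∀ z, Circle.exp (g' z) = f z) (y z : stdSimplex ℝ (Fin (n + 1))) :
    g z - g y = g' z - g' y := by
  let g'' : C(stdSimplex ℝ (Fin (n + 1)), ℝ) := ⟨fun u => g' u + (g y - g' y), by fun_prop⟩
  have h := (Circle.isCoveringMap_exp.existsUnique_continuousMap_lifts f y (g y) (hg y)).unique
    (y₁ := g) (y₂ := g'') ⟨rfl, funext hg⟩ ⟨by simp [g''], by
      funext u
      change Circle.exp (g' u + (g y - g' y)) = f u
      rw [Circle.exp_add, Circle.exp_sub, hg, hg', hg', div_self', mul_one]⟩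
  have := ContinuousMap.congr_fun h z
  simp only [g'', ContinuousMap.coe_mk] at this
  linarith

theorem exists_winding (f : C(stdSimplex ℝ (Fin 2), Circle)) :
    ∃ m : ℤ, ∀ g : C(stdSimplex ℝ (Fin 2), ℝ), (∀ z, Circle.exp (g z) = f z) →
      g (stdSimplex.vertex 1) - g (stdSimplex.vertex 0) =
        Complex.arg (f (stdSimplex.vertex 1)) - Complex.arg (f (stdSimplex.vertex 0)) +
          m * (2 * Real.pi) := by
  obtain ⟨g, hg⟩ := exists_lift f
  obtain ⟨m₁, h₁⟩ := Circle.exp_eq_exp.1 ((hg (stdSimplex.vertex 1)).trans (Circle.exp_arg _).symm)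
  obtain ⟨m₀, h₀⟩ := Circle.exp_eq_exp.1 ((hg (stdSimplex.vertex 0)).trans (Circle.exp_arg _).symm)
  refine ⟨m₁ - m₀, fun g' hg' => ?_⟩
  rw [sub_eq_sub_of_lifts hg' hg, h₀, h₁]
  push_cast
  ring

/-- The number of turns of a path in the circle relative to the branch cut of the argument. -/
noncomputable def winding (f : C(stdSimplex ℝ (Fin 2), Circle)) : ℤ := (exists_winding f).choose

theorem winding_spec (f : C(stdSimplex ℝ (Fin 2), Circle)) (g : C(stdSimplex ℝ (Fin 2), ℝ))
    (hg : ∀ z, Circle.exp (g z) = f z) :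
    g (stdSimplex.vertex 1) - g (stdSimplex.vertex 0) =
      Complex.arg (f (stdSimplex.vertex 1)) - Complex.arg (f (stdSimplex.vertex 0)) +
        winding f * (2 * Real.pi) := (exists_winding f).choose_spec g hg

/-- The face maps of topological simplices. -/
noncomputable def faceMap {n : ℕ} (i : Fin (n + 2)) :
    C(stdSimplex ℝ (Fin (n + 1)), stdSimplex ℝ (Fin (n + 2))) :=
  ⟨stdSimplex.map (SimplexCategory.δ i), stdSimplex.continuous_map _⟩

theorem faceMap_vertex {n : ℕ} (i : Fin (n + 2)) (j : Fin (n + 1)) :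
    faceMap i (stdSimplex.vertex j) = stdSimplex.vertex (i.succAbove j) :=
  stdSimplex.map_vertex _ _

/-- Lift `f` to `ℝ` over the whole triangle: the increments along the three edges cancel, and so do
the arguments at the vertices. -/
theorem winding_faces (f : C(stdSimplex ℝ (Fin 3), Circle)) :
    winding (f.comp (faceMap 0)) - winding (f.comp (faceMap 1)) + winding (f.comp (faceMap 2)) =
      0 := by
  obtain ⟨g, hg⟩ := exists_lift f
  have key (i : Fin 3) := winding_spec (f.comp (faceMap i)) (g.comp (faceMap i)) fun z => hg _
  have h₀ := key 0
  have h₁ := key 1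
  have h₂ := key 2
  simp only [ContinuousMap.comp_apply, faceMap_vertex] at h₀ h₁ h₂
  have e₀ : (0 : Fin 3).succAbove (0 : Fin 2) = 1 := rfl
  have e₁ : (0 : Fin 3).succAbove (1 : Fin 2) = 2 := rfl
  have e₂ : (1 : Fin 3).succAbove (0 : Fin 2) = 0 := rfl
  have e₃ : (1 : Fin 3).succAbove (1 : Fin 2) = 2 := rfl
  have e₄ : (2 : Fin 3).succAbove (0 : Fin 2) = 0 := rfl
  have e₅ : (2 : Fin 3).succAbove (1 : Fin 2) = 1 := rfl
  rw [e₀, e₁] at h₀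
  rw [e₂, e₃] at h₁
  rw [e₄, e₅] at h₂
  have hpi : (2 * Real.pi) ≠ 0 := by positivity
  have : ((winding (f.comp (faceMap 0)) : ℝ) - winding (f.comp (faceMap 1)) +
      winding (f.comp (faceMap 2))) * (2 * Real.pi) = 0 := by linarith
  have := (mul_eq_zero.1 this).resolve_right hpi
  exact_mod_cast this

theorem continuous_coord_mul_const (r : ℝ) :
    Continuous fun p : stdSimplex ℝ (Fin 2) => p.1 1 * r :=
  ((continuous_apply 1).comp continuous_subtype_val).mul continuous_const

/-- The standard loop as a singular simplex. -/
noncomputable def loopSimplex : C(stdSimplex ℝ (Fin 2), Circle) :=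
  ⟨fun p => Circle.exp (p.1 1 * (2 * Real.pi)),
    Circle.exp.continuous.comp (continuous_coord_mul_const _)⟩

theorem loopSimplex_vertex (j : Fin 2) : loopSimplex (stdSimplex.vertex j) = 1 := by
  change Circle.exp (Pi.single (M := fun _ => ℝ) j (1 : ℝ) 1 * (2 * Real.pi)) = 1
  fin_cases j <;> simp

theorem winding_loopSimplex : winding loopSimplex = 1 := by
  have := winding_spec loopSimplex 
    ⟨fun p => p.1 1 * (2 * Real.pi), continuous_coord_mul_const _⟩ fun _ => rfl
  rw [loopSimplex_vertex, loopSimplex_vertex] at this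
  have h : (1 : ℝ) * (2 * Real.pi) = winding loopSimplex * (2 * Real.pi) := by
    simpa using this
  have hpi : (2 * Real.pi) ≠ 0 := by positivity
  exact_mod_cast (mul_right_cancel₀ hpi h).symm

theorem not_isZero_H2_circle : ¬ IsZero ((H2 1).obj (TopCat.of Circle)) := by
  let X := TopCat.of Circle
  let x := (X.toSSetObjEquiv (.op ⦋1⦌)).symm loopSimplex
  have hx : X.toSSetObjEquiv (.op ⦋1⦌) x = loopSimplex := Equiv.apply_symm_apply _ _
  refine not_isZero_homology_one (X := TopCat.toSSet.obj X)
    (fun y => (winding (X.toSSetObjEquiv (.op ⦋1⦌) y) : ZMod 2)) (fun t => ?_) x ?_ ?_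
  · have := winding_faces (X.toSSetObjEquiv (.op ⦋2⦌) t)
    exact_mod_cast congrArg (Int.cast : ℤ → ZMod 2) this
  · refine (X.toSSetObjEquiv (.op ⦋0⦌)).injective ?_
    have key (i : Fin 2) : X.toSSetObjEquiv (.op ⦋0⦌) ((TopCat.toSSet.obj X).δ i x) =
        ContinuousMap.const _ (1 : Circle) := by
      change (X.toSSetObjEquiv (.op ⦋1⦌) x).comp (faceMap i) = _
      rw [hx]
      ext1 z
      obtain rfl : z = stdSimplex.vertex 0 := Subsingleton.elim _ _
      rw [ContinuousMap.comp_apply, faceMap_vertex, loopSimplex_vertex]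
      rfl
    rw [key, key]
  · rw [hx, winding_loopSimplex]
    simp

end Winding

/-! ### Reduced homology -/

theorem isZero_H2_one_point : IsZero ((H2 1).obj (TopCat.of PUnit.{1})) :=
  isZero_singularHomologyFunctor_of_totallyDisconnectedSpace _ _ _ _ one_ne_zero

theorem H2_map_eq_of_homotopic (n : ℕ) {X Y : TopCat.{0}} {f g : X ⟶ Y}
    (h : f.hom.Homotopic g.hom) : (H2 n).map f = (H2 n).map g :=
  h.elim fun H => TopCat.Homotopy.congr_homologyMap_singularChainComplexFunctor H _ n

/-- Since `H₁` of a point is zero, vanishing reduced homology forces `H₁(X) = 0`; but the identity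
of `H₁(S¹)` factors through it. -/
theorem not_isZero_reducedH2_one {X : TopCat.{0}} (f : X ⟶ TopCat.of Circle)
    (g : TopCat.of Circle ⟶ X) (h : (g ≫ f).hom.Homotopic (ContinuousMap.id _)) :
    ¬ IsZero (reducedH2 X 1) := by
  intro h0
  have h1 : Mono ((H2 1).map (toPoint X)) := Preadditive.mono_of_isZero_kernel _ h0
  have h2 : IsZero ((H2 1).obj X) := IsZero.of_mono ((H2 1).map (toPoint X)) isZero_H2_one_point
  refine not_isZero_H2_circle ?_
  have h3 : (H2 1).map g ≫ (H2 1).map f = 𝟙 _ := by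
    rw [← Functor.map_comp, ← (H2 1).map_id]
    exact H2_map_eq_of_homotopic 1 h
  rw [IsZero.iff_id_eq_zero, ← h3, h2.eq_of_tgt ((H2 1).map g) 0, zero_comp]

/-- The augmentation of a path-connected space as an isomorphism. -/
noncomputable def augmentationIso (X : TopCat.{0}) [PathConnectedSpace X] :
    (H2 0).obj X ≅ ModuleCat.of (ZMod 2) (ZMod 2) :=
  have h : IsIso (X.singularHomology₀ε (ModuleCat.of (ZMod 2) (ZMod 2))) := inferInstance
  @asIso _ _ _ _ (X.singularHomology₀ε _) h

theorem isZero_reducedH2_of_lt_one {X : TopCat.{0}} [PathConnectedSpace X] {i : ℤ} (hi : i < 1) :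
    IsZero (reducedH2 X i) := by
  obtain ⟨x⟩ : Nonempty X := inferInstance
  let s : TopCat.of PUnit.{1} ⟶ X := TopCat.ofHom (ContinuousMap.const _ x)
  have hs : (H2 0).map s ≫ (H2 0).map (toPoint X) = 𝟙 _ := by
    rw [← Functor.map_comp, ← (H2 0).map_id]
    rfl
  have hepi : Epi ((H2 0).map (toPoint X)) := (SplitEpi.mk _ hs).epi
  obtain n | n := i
  · obtain rfl : n = 0 := by
      have : (n : ℤ) < 1 := hi
      omega
    let e₁ := augmentationIso X
    let e₂ := augmentationIso (TopCat.of PUnit.{1})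
    -- Both groups are copies of `ℤ/2`, and a surjective self-map of a finite set is injective.
    have hmono : Mono ((H2 0).map (toPoint X)) := by
      have hf : Mono (e₁.inv ≫ (H2 0).map (toPoint X) ≫ e₂.hom) := by
        rw [ModuleCat.mono_iff_injective]
        have hsurj := (ModuleCat.epi_iff_surjective
          (e₁.inv ≫ (H2 0).map (toPoint X) ≫ e₂.hom)).1 inferInstance
        exact (Finite.injective_iff_surjective (α := ZMod 2)).2 hsurj
      have : (H2 0).map (toPoint X) =
          e₁.hom ≫ (e₁.inv ≫ (H2 0).map (toPoint X) ≫ e₂.hom) ≫ e₂.inv := by simp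
      rw [this]
      infer_instance
    exact isZero_kernel_of_mono _
  · obtain _ | n := n
    · exact isZero_cokernel_of_epi _
    · exact ModuleCat.isZero_of_subsingleton (ModuleCat.of (ZMod 2) PUnit)

theorem isZero_reducedH2_iff_of_iso {X Y : TopCat.{0}} (e : X ≅ Y) (i : ℤ) :
    IsZero (reducedH2 X i) ↔ IsZero (reducedH2 Y i) := by
  have h (n : ℕ) : (H2 n).map (toPoint X) = (H2 n).map e.hom ≫ (H2 n).map (toPoint Y) := by
    rw [← Functor.map_comp]
    rfl
  obtain n | _ | n := i
  · change IsZero (kernel ((H2 n).map (toPoint X))) ↔ IsZero (kernel ((H2 n).map (toPoint Y)))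
    rw [h]
    exact (kernelIsIsoComp ((H2 n).map e.hom) ((H2 n).map (toPoint Y))).isZero_iff
  · change IsZero (cokernel ((H2 0).map (toPoint X))) ↔ IsZero (cokernel ((H2 0).map (toPoint Y)))
    rw [h]
    exact (cokernelEpiComp ((H2 0).map e.hom) ((H2 0).map (toPoint Y))).isZero_iff
  · exact Iff.rfl

theorem homologyTestBound_eq_of_homeomorph {W V V' : Type} [Fintype V] [Fintype V']
    {T : SimpleGraph W} {G : SimpleGraph V} {G' : SimpleGraph V'}
    (e : homComplex T G ≃ₜ homComplex T G') : homologyTestBound T G = homologyTestBound T G' := by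
  simp only [homologyTestBound, isZero_reducedH2_iff_of_iso (TopCat.isoOfHomeo
    (X := TopCat.of (homComplex T G)) (Y := TopCat.of (homComplex T G')) e)]

/-- The bound is `3` if `Hom(K₂, G)` is path-connected and dominates a circle. -/
theorem homologyTestBound_K2_eq_three {V : Type} [Fintype V] {G : SimpleGraph V}
    [PathConnectedSpace (homComplex (K 2) G)] (f : C(homComplex (K 2) G, Circle))
    (g : C(Circle, homComplex (K 2) G)) (h : (f.comp g).Homotopic (ContinuousMap.id _)) :
    homologyTestBound (K 2) G = 3 := by
  have hχ : (K 2).chromaticNumber = 2 := by simp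
  rw [homologyTestBound, hχ]
  apply le_antisymm
  · refine iSup₂_le fun k hk => ?_
    -- Any `k ≥ 2` would require vanishing in degree 1.
    have hk1 : k ≤ 1 := by
      by_contra! hlt
      exact not_isZero_reducedH2_one (X := TopCat.of (homComplex (K 2) G)) (TopCat.ofHom f)
        (TopCat.ofHom g) h (hk 1 (by exact_mod_cast hlt))
    have : ((k + 2 : ℕ) : ℕ∞) ≤ (3 : ℕ) := by exact_mod_cast (by omega : k + 2 ≤ 3)
    exact_mod_cast this
  · have : PathConnectedSpace (TopCat.of (homComplex (K 2) G)) := ‹_›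
    exact le_iSup₂_of_le (f := fun (k : ℕ) _ => (k : ℕ∞) + 2) 1
      (fun i hi => isZero_reducedH2_of_lt_one (by exact_mod_cast hi)) (by norm_num)

end HomTest

/-! ### Triangles, the glued graph and the conclusion -/

namespace HomTest

theorem exists_two_others (x : Fin 3) : ∃ y z : Fin 3, x ≠ y ∧ x ≠ z ∧ y ≠ z := by
  revert x
  decide

/-! ### Gluing along vertices -/

namespace IsGluing

variable {V₁ V₂ V ι : Type*} {G₁ : SimpleGraph V₁} {G₂ : SimpleGraph V₂}
    {G : SimpleGraph V} {φ₁ : V₁ → V} {φ₂ : V₂ → V} {v : ι → V₁} {w : ι → V₂}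
    (h : IsGluing G₁ G₂ G φ₁ φ₂ v w)

include h

/-- If `G₂` is triangle-free, the triangles of the gluing lie in `G₁`. -/
theorem mem_range_of_triangle (htri : G₂.CliqueFree 3) {x y z : V} (hxy : G.Adj x y)
    (hxz : G.Adj x z) (hyz : G.Adj y z) : x ∈ Set.range φ₁ := by
  classical
  -- If neither edge at `x` comes from `G₁`, all three vertices lie in `V₂`, and `adj₂` yields a
  -- forbidden triangle.
  obtain ⟨a, -, ha, -⟩ | ⟨a, b, rfl, rfl⟩ := h.exists_of_adj hxy
  · exact ⟨a, ha⟩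
  obtain ⟨a', -, ha, -⟩ | ⟨a', c, -, rfl⟩ := h.exists_of_adj hxz
  · exact ⟨a', ha⟩
  exact (htri {a, b, c} (SimpleGraph.is3Clique_triple_iff.2
    ⟨h.adj₂.1 hxy, h.adj₂.1 hxz, h.adj₂.1 hyz⟩)).elim

theorem homCells_K3 (htri : G₂.CliqueFree 3) :
    homCells (K 3) G = (fun τ x => φ₁ '' τ x) '' homCells (K 3) G₁ := by
  ext τ
  constructor
  · rintro ⟨hne, hτ⟩
    have hrange (x : Fin 3) (a : V) (ha : a ∈ τ x) : a ∈ Set.range φ₁ := by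
      obtain ⟨y, z, hxy, hxz, hyz⟩ := exists_two_others x
      obtain ⟨b, hb⟩ := hne y
      obtain ⟨c, hc⟩ := hne z
      exact h.mem_range_of_triangle htri (hτ x y hxy a ha b hb) (hτ x z hxz a ha c hc)
        (hτ y z hyz b hb c hc)
    have himage (x : Fin 3) : φ₁ '' (φ₁ ⁻¹' τ x) = τ x :=
      Set.image_preimage_eq_of_subset (hrange x)
    refine ⟨fun x => φ₁ ⁻¹' τ x, ⟨fun x => ?_, fun x y hxy a ha b hb =>
      h.adj₁.1 (hτ x y hxy _ ha _ hb)⟩, funext himage⟩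
    obtain ⟨a, ha⟩ := hne x
    obtain ⟨a, rfl⟩ := hrange x a ha
    exact ⟨a, ha⟩
  · rintro ⟨τ, ⟨hne, hτ⟩, rfl⟩
    refine ⟨fun x => (hne x).image _, ?_⟩
    rintro x y hxy _ ⟨a, ha, rfl⟩ _ ⟨b, hb, rfl⟩
    exact h.adj₁.2 (hτ x y hxy a ha b hb)

theorem nonempty_homeomorph_K3 [Fintype V₁] [Fintype V] (htri : G₂.CliqueFree 3) :
    Nonempty (homComplex (K 3) G₁ ≃ₜ homComplex (K 3) G) := by
  refine nonempty_homeomorph_of_support h.injective₁ h.adj₁ fun p hp x a ha => ?_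
  obtain ⟨hp₁, hp₂⟩ := mem_homComplex_iff.1 hp
  obtain ⟨y, z, hxy, hxz, hyz⟩ := exists_two_others x
  obtain ⟨b, hb⟩ := exists_ne_zero_of_mem_stdSimplex (hp₁ y)
  obtain ⟨c, hc⟩ := exists_ne_zero_of_mem_stdSimplex (hp₁ z)
  exact h.mem_range_of_triangle htri (hp₂ x y hxy a b ha hb) (hp₂ x z hxz a c ha hc)
    (hp₂ y z hyz b c hb hc)

theorem not_colorable {n : ℕ} (hn : ¬ G₁.Colorable n) : ¬ G.Colorable n := by
  rintro ⟨C⟩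
  exact hn ⟨C.comp ⟨φ₁, h.adj₁.2⟩⟩

theorem connected (h₁ : G₁.Connected) (h₂ : G₂.Connected) (i : ι)
    (hcover : ∀ x, x ∈ Set.range φ₁ ∨ x ∈ Set.range φ₂) : G.Connected := by
  have key (x : V) : G.Reachable x (φ₁ (v i)) := by
    obtain ⟨a, rfl⟩ | ⟨b, rfl⟩ := hcover x
    · exact (h₁.preconnected a (v i)).map (⟨φ₁, h.adj₁.2⟩ : G₁ →g G)
    · rw [h.glue]
      exact (h₂.preconnected b (w i)).map (⟨φ₂, h.adj₂.2⟩ : G₂ →g G)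
  have : Nonempty V := ⟨φ₁ (v i)⟩
  exact ⟨fun x y => (key x).trans (key y).symm⟩

end IsGluing

theorem exists_of_glueInl_eq_glueInr {V₁ V₂ : Type*} {t : ℕ} {v : Fin t ↪ V₁} {w : Fin t ↪ V₂}
    {a : V₁} {b : V₂} (hab : glueInl v w a = glueInr v w b) : ∃ i, v i = a ∧ w i = b := by
  classical
  -- Replacing each `w i` by `v i` is constant on the identified pairs and so chooses normal forms
  -- for the quotient.
  let f : V₁ ⊕ V₂ → V₁ ⊕ V₂ := Sum.elim Sum.inl
    (fun b => if h : ∃ i, w i = b then Sum.inl (v h.choose) else Sum.inr b)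
  have hf : ∀ a b, GlueRel v w a b → f a = f b := by
    rintro _ _ ⟨i⟩
    have h : ∃ j, w j = w i := ⟨i, rfl⟩
    have hc : h.choose = i := w.injective h.choose_spec
    simp only [f, Sum.elim_inl, Sum.elim_inr, dif_pos h, hc]
  have heq : (Sum.inl a : V₁ ⊕ V₂) = f (Sum.inr b) := congrArg (Quot.lift f hf) hab
  by_cases h : ∃ i, w i = b
  · refine ⟨h.choose, ?_, h.choose_spec⟩
    simp only [f, Sum.elim_inr, dif_pos h] at heq
    exact (Sum.inl_injective heq).symm
  · simp [f, dif_neg h] at heq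

theorem not_adj_of_three_le_edist {V : Type*} {G : SimpleGraph V} {x y : V}
    (h : 3 ≤ G.edist x y) : ¬ G.Adj x y := by
  intro hxy
  have := h.trans (SimpleGraph.edist_le hxy.toWalk)
  simp at this

theorem not_adj_adj_of_three_le_edist {V : Type*} {G : SimpleGraph V} {x y z : V}
    (h : 3 ≤ G.edist x y) (hx : G.Adj x z) (hy : G.Adj y z) : False := by
  have := h.trans (SimpleGraph.edist_le (SimpleGraph.Walk.cons hx hy.symm.toWalk))
  norm_num at this

/-- The delicate point is that both parts are induced subgraphs: an edge of one part between
vertices of the other would join two glued vertices. -/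
theorem isGluing_glueGraph {V₁ V₂ : Type*} {t : ℕ} (G₁ : SimpleGraph V₁) (G₂ : SimpleGraph V₂)
    (v : Fin t ↪ V₁) (w : Fin t ↪ V₂)
    (hdist : ∀ i j : Fin t, i ≠ j →
      3 ≤ (glueGraph G₁ G₂ v w).edist (glueInl v w (v i)) (glueInl v w (v j))) :
    IsGluing G₁ G₂ (glueGraph G₁ G₂ v w) (glueInl v w) (glueInr v w) v w := by
  have glue (i) : glueInl v w (v i) = glueInr v w (w i) := Quot.sound ⟨i⟩
  have hadj (x y) : (glueGraph G₁ G₂ v w).Adj x y ↔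
      (∃ a a', G₁.Adj a a' ∧ glueInl v w a = x ∧ glueInl v w a' = y) ∨
        ∃ b b', G₂.Adj b b' ∧ glueInr v w b = x ∧ glueInr v w b' = y := by
    exact or_congr (SimpleGraph.map_adj ⟨_, glueInl_injective v w⟩ G₁ x y)
      (SimpleGraph.map_adj ⟨_, glueInr_injective v w⟩ G₂ x y)
  have hnot (i j) : ¬ (glueGraph G₁ G₂ v w).Adj (glueInl v w (v i)) (glueInl v w (v j)) := by
    by_cases hij : i = j
    · rw [hij]
      exact SimpleGraph.irrefl _
    · exact not_adj_of_three_le_edist (hdist i j hij)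
  refine ⟨glueInl_injective v w, glueInr_injective v w, fun {a a'} => ⟨fun h => ?_, fun h => ?_⟩,
    fun {b b'} => ⟨fun h => ?_, fun h => ?_⟩, fun {x y} h => ?_, glue, exists_of_glueInl_eq_glueInr,
    hnot, fun i j x hi hj => ?_⟩
  · obtain ⟨c, c', hc, hca, hca'⟩ | ⟨b, b', -, hb, hb'⟩ := (hadj _ _).1 h
    · rwa [glueInl_injective v w hca, glueInl_injective v w hca'] at hc
    · obtain ⟨i, rfl, -⟩ := exists_of_glueInl_eq_glueInr hb.symm
      obtain ⟨j, rfl, -⟩ := exists_of_glueInl_eq_glueInr hb'.symm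
      exact (hnot i j h).elim
  · exact (hadj _ _).2 (Or.inl ⟨a, a', h, rfl, rfl⟩)
  · obtain ⟨a, a', -, ha, ha'⟩ | ⟨c, c', hc, hcb, hcb'⟩ := (hadj _ _).1 h
    · obtain ⟨i, -, rfl⟩ := exists_of_glueInl_eq_glueInr ha
      obtain ⟨j, -, rfl⟩ := exists_of_glueInl_eq_glueInr ha'
      rw [← glue, ← glue] at h
      exact (hnot i j h).elim
    · rwa [glueInr_injective v w hcb, glueInr_injective v w hcb'] at hc
  · exact (hadj _ _).2 (Or.inr ⟨b, b', h, rfl, rfl⟩)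
  · obtain ⟨a, a', -, ha⟩ | ⟨b, b', -, hb⟩ := (hadj _ _).1 h
    exacts [Or.inl ⟨a, a', ha⟩, Or.inr ⟨b, b', hb⟩]
  · by_contra hij
    exact not_adj_adj_of_three_le_edist (hdist i j hij) hi hj

theorem mem_range_glueInl_or_glueInr {V₁ V₂ : Type*} {t : ℕ} (v : Fin t ↪ V₁) (w : Fin t ↪ V₂)
    (x : GlueVertex v w) : x ∈ Set.range (glueInl v w) ∨ x ∈ Set.range (glueInr v w) := by
  obtain ⟨a | b, rfl⟩ := Quot.exists_rep x
  exacts [Or.inl ⟨a, rfl⟩, Or.inr ⟨b, rfl⟩]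

/-- A wedge with at least one circle retracts onto a circle. -/
theorem exists_homotopic_id_of_homotopyEquiv_wedgeCircles {S X Y : Type*} [TopologicalSpace S]
    [TopologicalSpace X] [TopologicalSpace Y] {x : X} {y : Y} {n : ℕ} (j : Fin n)
    (e : S ≃ₕ WedgeCircles x y n) :
    ∃ (f : C(S, Circle)) (g : C(Circle, S)), (f.comp g).Homotopic (ContinuousMap.id _) := by
  classical
  -- Everything except the `j`-th circle is collapsed to the base point.
  let r : C(WedgeCircles x y n, Circle) := WedgeCircles.desc (ContinuousMap.const _ 1)
    (ContinuousMap.const _ 1) (fun i => if i = j then ContinuousMap.id _ else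
      ContinuousMap.const _ 1) rfl (fun i => by split_ifs <;> rfl)
  have hr : r.comp (WedgeCircles.circle x y n j) = ContinuousMap.id _ := by
    ext1 z
    change (if j = j then ContinuousMap.id Circle else ContinuousMap.const _ 1) z = z
    rw [if_pos rfl]
    rfl
  refine ⟨r.comp e.toFun, e.invFun.comp (WedgeCircles.circle x y n j), ?_⟩
  have := (ContinuousMap.Homotopic.refl r).comp
    (e.right_inv.comp (ContinuousMap.Homotopic.refl (WedgeCircles.circle x y n j)))
  rw [ContinuousMap.id_comp, hr] at this
  exact this

theorem not_colorable_two_of_three_le {V : Type*} {G : SimpleGraph V}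
    (h : 3 ≤ G.chromaticNumber) : ¬ G.Colorable 2 := by
  intro h2
  have := h.trans h2.chromaticNumber_le
  norm_num at this

end HomTest

theorem proposition4p5 {V₁ V₂ : Type} [Fintype V₁] [Fintype V₂]
    (G₁ : SimpleGraph V₁) (G₂ : SimpleGraph V₂)
    (hconn₁ : G₁.Connected) (hconn₂ : G₂.Connected)
    (hχ : G₂.chromaticNumber ≤ G₁.chromaticNumber) (hχ₂ : 3 ≤ G₂.chromaticNumber)
    (htri : G₂.CliqueFree 3)
    (t : ℕ) (ht : 1 ≤ t) (v : Fin t ↪ V₁) (w : Fin t ↪ V₂)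
    (hdist : ∀ i j : Fin t, i ≠ j →
      3 ≤ (glueGraph G₁ G₂ v w).edist (glueInl v w (v i)) (glueInl v w (v j))) :
    homCells (K 3) (glueGraph G₁ G₂ v w)
        = (fun σ x => glueInl v w '' σ x) '' homCells (K 3) G₁ ∧
    homologyTestBound (K 3) (glueGraph G₁ G₂ v w) = homologyTestBound (K 3) G₁ ∧
    (homComplex (K 2) G₁).Nonempty ∧ (homComplex (K 2) G₂).Nonempty ∧
    (∀ (x : homComplex (K 2) G₁) (y : homComplex (K 2) G₂),
      Nonempty (homComplex (K 2) (glueGraph G₁ G₂ v w) ≃ₕ WedgeCircles x y (2 * t - 1))) ∧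
    homologyTestBound (K 2) (glueGraph G₁ G₂ v w) = 3 := by
  classical
  have h := isGluing_glueGraph G₁ G₂ v w hdist
  have hc₂ := not_colorable_two_of_three_le hχ₂
  have hc₁ := not_colorable_two_of_three_le (hχ₂.trans hχ)
  have hG := h.connected hconn₁ hconn₂ ⟨0, ht⟩ (mem_range_glueInl_or_glueInr v w)
  have hn₁ := (isPathConnected_homComplex_K2 hconn₁ hc₁).nonempty
  have hn₂ := (isPathConnected_homComplex_K2 hconn₂ hc₂).nonempty
  have equiv (x : homComplex (K 2) G₁) (y : homComplex (K 2) G₂) :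
      Nonempty (homComplex (K 2) (glueGraph G₁ G₂ v w) ≃ₕ WedgeCircles x y (2 * t - 1)) :=
    h.nonempty_homotopyEquiv hconn₁ hconn₂ hc₁ hc₂
      -- There are `2 * t` bridges, one per glued vertex and coordinate; `1 ≤ t` makes this `(2 * t
      -- - 1) + 1` despite truncated subtraction.
      (Fintype.equivOfCardEq (by simp only [Fintype.card_prod, Fintype.card_fin]; omega)) x y
  refine ⟨h.homCells_K3 htri, ?_, hn₁, hn₂, equiv, ?_⟩
  · obtain ⟨e⟩ := h.nonempty_homeomorph_K3 htri
    exact (homologyTestBound_eq_of_homeomorph e).symm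
  · have : PathConnectedSpace (homComplex (K 2) (glueGraph G₁ G₂ v w)) :=
      isPathConnected_iff_pathConnectedSpace.1
        (isPathConnected_homComplex_K2 hG (h.not_colorable hc₁))
    obtain ⟨e⟩ := equiv ⟨_, hn₁.some_mem⟩ ⟨_, hn₂.some_mem⟩
    obtain ⟨f, g, hfg⟩ :=
      exists_homotopic_id_of_homotopyEquiv_wedgeCircles ⟨0, by omega⟩ e
    exact homologyTestBound_K2_eq_three f g hfg
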